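/- **Hybrid systems.** A hybrid system $H=(Q,E,D,F,G,R)$ consists of a finite set $Q$ of modes, edges $E\subseteq Q\times Q$, domains $D_q\subseteq\mathbb R^n$, vector fields $f_q$ on $D_q$, guards $G_e\subseteq D_q$ and reset maps $\phi_e:G_e\to D_{q'}$ for $e=(q,q')\in E$. It is *cyclic* if each mode is the source of exactly one edge and the target of exactly one edge, and the digraph $(Q,E)$ is connected. A *Zeno equilibrium* is a family $z=\{z_q\}_{q\in Q}$ with $z_q\in D_q$, $f_q(z_q)\ne0$ for all $q$, and $z_q\in G_e$, $\phi_e(z_q)=z_{q'}$ for all $e=(q,q')\in E$. **Executions.** An *execution* from $(q_0,x_0)$ consists of a nonempty initial segment $I\subseteq\{0,1,2,\dots\}$, times $0=\tau_0\le\tau_1\le\cdots$ (only the end of a last interval may be $+\infty$), modes $q_i$ and curves $c_i$, $i\in I$, such that $c_0(0)=x_0$; $c_i$ is continuous on $[\tau_i,\tau_{i+1})$, and on $[\tau_i,\tau_{i+1}]$ if $i+1\in I$; on $(\tau_i,\tau_{i+1})$ one has $\dot c_i=f_{q_i}(c_i)$ and $c_i\in D_{q_i}$; and, if $i+1\in I$,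 then $(q_i,q_{i+1})\in E$, $c_i(\tau_{i+1})\in G_{(q_i,q_{i+1})}$ and $c_{i+1}(\tau_{i+1})=\phi_{(q_i,q_{i+1})}(c_i(\tau_{i+1}))$. It is *complete* if $I$ is infinite or its last interval is unbounded, *maximal* if it has no proper extension, and *Zeno* if $I$ is infinite and $\lim_i\tau_i<\infty$. It *converges to $z$* if for every $\epsilon>0$ there is $N$ with $\|c_i(\tau_{i+1})-z_{q_i}\|\le\epsilon$ for all $i>N$. The system is *non-blocking near $z$* if each $z_q$ has a neighbourhood in which every $x\in D_q$ lies in a guard $G_e$ with $e$ starting at $q$, or is the starting point of a solution of $\dot x=f_q(x)$ that stays in $D_q$ for a positive time. **Zeno stability.** $z$ is *Zeno stable* if there are neighbourhoods $Z_q$ of $z_q$ such that for every $q$ and $x\in Z_q\cap D_q$: every complete execution from $(q,x)$ is Zeno and converges to $z$; and, if $H$ is non-blocking near $z$, then a Zeno execution from $(q,x)$ exists and every maximal execution from $(q,x)$ is Zeno and converges to $z$. **Theorem.** Let $P=\{p\in\mathbb R^{m}:\pi_k(p)\ge0,\ k=1,\dots,K_1\}$ with polynomials $\pi_k$, and for $p\in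 P$ let $H(p)$ be the cyclic hybrid system with fixed $Q,E$ and $$D_q(p)=\{x\in\mathbb R^n: g_{qk}(x,p)\ge0,\ k\le K_q\},$$ $$G_e(p)=\{x\in D_q(p): h_{e,0}(x,p)=0,\ h_{e,l}(x,p)\ge0,\ l\le N_e\}\quad(e=(q,q')),$$ with vector fields $f_q(x,p)$ and resets $\phi_e(x,p)$, all polynomial in $(x,p)$. Let $z=\{z_q\}$ be a Zeno equilibrium of $H(p)$ for every $p\in P$. Let $w_{qk}\in\mathbb R[x]$, $k\le K_{qw}$, be such that $W_q=\{x: w_{qk}(x)>0\text{ for all }k\}$ is a neighbourhood of $z_q$ for each $q$. Let $\Sigma_{x,p}$ be the set of sums of squares of polynomials in $\mathbb R[x,p]$. Suppose that there are $a_{qk},b_{qk},c_{qk},d_{qk},i_{qk},j_{qk},\eta_{qk},\beta_{qk},\zeta_{qk},m_{e,l}\in\Sigma_{x,p}$ ($l\ge1$), polynomials $V_q,m_{e,0}\in\mathbb R[x,p]$, and constants $\alpha,\gamma>0$, $r_q\in(0,1]$ with $r_q<1$ for some $q$, such that, for all $q\in Q$, $$V_q-\alpha x^Tx-\sum_k a_{qk}w_{qk}-\sum_k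 b_{qk}g_{qk}-\sum_k\eta_{qk}\pi_k\in\Sigma_{x,p},\qquad V_q(z_q,p)=0\ \text{ for all }p\in P,$$ $$-(\nabla_xV_q)^Tf_q-\gamma-\sum_kc_{qk}w_{qk}-\sum_kd_{qk}g_{qk}-\sum_k\beta_{qk}\pi_k\in\Sigma_{x,p},$$ and, for all $e=(q,q')\in E$, $$r_qV_q-V_{q'}(\phi_e(x,p),p)-m_{e,0}h_{e,0}-\sum_{l\ge1}m_{e,l}h_{e,l}-\sum_ki_{qk}w_{qk}-\sum_kj_{qk}g_{qk}-\sum_k\zeta_{qk}\pi_k\in\Sigma_{x,p}.$$ Then, for every $p\in P$, $z$ is a Zeno equilibrium of $H(p)$ and is Zeno stable for $H(p)$. -/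

import Mathlib

open Set Filter Topology

noncomputable section

namespace ZenoSOS

/-- The continuous state space `ℝⁿ` with its Euclidean norm. -/
abbrev State (n : ℕ) : Type := EuclideanSpace ℝ (Fin n)

/-- A hybrid system `(Q, E, D, F, G, R)`. The vector fields and reset maps are total functions, of
which only the values on the domains, respectively on the guards, are used. -/
structure HybridSystem (Q : Type*) (n : ℕ) where
  /-- edges -/
  E : Set (Q × Q)
  /-- domains -/
  D : Q → Set (State n)
  /-- vector fields -/
  f : Q → State n → State n
  /-- guards -/
  G : Q × Q → Set (State n)
  /-- reset maps -/
  φ : Q × Q → State n → State n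
  guard_subset : ∀ e ∈ E, G e ⊆ D e.1
  reset_mapsTo : ∀ e ∈ E, MapsTo (φ e) (G e) (D e.2)

/-- The data `(I, T, p, C)` of an execution: the index set `I` of the intervals (numbered from `0`),
the times `τ i`, which give the open intervals `(τ i, τ (i + 1))`, the modes, and the curves.
Values at indices and times that do not belong to the execution are irrelevant. -/
structure Arc (Q : Type*) (n : ℕ) where
  I : Set ℕ
  τ : ℕ → EReal
  mode : ℕ → Q
  c : ℕ → ℝ → State n

namespace HybridSystem

variable {Q : Type*} {n : ℕ}

/-- A hybrid system is cyclic if every mode is the source of exactly one edge and the target of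
exactly one edge, and the digraph of modes and edges is connected. -/
structure IsCyclic (H : HybridSystem Q n) : Prop where
  source : ∀ q, ∃! e, e ∈ H.E ∧ e.1 = q
  target : ∀ q, ∃! e, e ∈ H.E ∧ e.2 = q
  connected : ∀ a b, Relation.EqvGen (fun u v => (u, v) ∈ H.E) a b

/-- `χ` is an execution of `H` with initial condition `(q₀, x₀)`. Intervals of length zero are
allowed. The end of the last interval, if there is one, may be infinite. -/
structure IsExecution (H : HybridSystem Q n) (q₀ : Q) (x₀ : State n) (χ : Arc Q n) : Prop where
  zero_mem : 0 ∈ χ.I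
  mem_of_succ_mem : ∀ i, i + 1 ∈ χ.I → i ∈ χ.I
  time_zero : χ.τ 0 = 0
  time_ne_top : ∀ i ∈ χ.I, χ.τ i ≠ ⊤
  time_le : ∀ i ∈ χ.I, χ.τ i ≤ χ.τ (i + 1)
  init_mode : χ.mode 0 = q₀
  init_state : χ.c 0 0 = x₀
  continuous : ∀ i ∈ χ.I, ContinuousOn (χ.c i) {t : ℝ | χ.τ i ≤ t ∧ t < χ.τ (i + 1)}
  continuous_end : ∀ i, i + 1 ∈ χ.I →
    ContinuousOn (χ.c i) {t : ℝ | χ.τ i ≤ t ∧ t ≤ χ.τ (i + 1)}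
  flow : ∀ i ∈ χ.I, ∀ t : ℝ, χ.τ i < t → t < χ.τ (i + 1) →
    HasDerivAt (χ.c i) (H.f (χ.mode i) (χ.c i t)) t
  domain : ∀ i ∈ χ.I, ∀ t : ℝ, χ.τ i < t → t < χ.τ (i + 1) → χ.c i t ∈ H.D (χ.mode i)
  edge : ∀ i, i + 1 ∈ χ.I → (χ.mode i, χ.mode (i + 1)) ∈ H.E
  guard : ∀ i, i + 1 ∈ χ.I →
    χ.c i (χ.τ (i + 1)).toReal ∈ H.G (χ.mode i, χ.mode (i + 1))
  reset : ∀ i, i + 1 ∈ χ.I →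
    χ.c (i + 1) (χ.τ (i + 1)).toReal =
      H.φ (χ.mode i, χ.mode (i + 1)) (χ.c i (χ.τ (i + 1)).toReal)

end HybridSystem

namespace Arc

variable {Q : Type*} {n : ℕ}

/-- Infinitely many transitions in finite time. -/
def IsZeno (χ : Arc Q n) : Prop :=
  χ.I = univ ∧ ∃ L : ℝ, Tendsto χ.τ atTop (𝓝 (L : EReal))

/-- The states at the ends of the intervals converge to the points `z q` of the current modes. -/
def ConvergesTo (χ : Arc Q n) (z : Q → State n) : Prop :=
  ∀ ε > 0, ∃ N : ℕ, ∀ i > N, ‖χ.c i (χ.τ (i + 1)).toReal - z (χ.mode i)‖ ≤ ε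

/-- Infinitely many transitions, or a last interval that is unbounded. -/
def IsComplete (χ : Arc Q n) : Prop :=
  χ.I = univ ∨ ∃ i ∈ χ.I, χ.τ (i + 1) = ⊤

/-- `χ.Le χ'`: the arc `χ'` is an extension of `χ` (possibly `χ` itself). -/
def Le (χ χ' : Arc Q n) : Prop :=
  χ.I ⊆ χ'.I ∧ ∀ i ∈ χ.I,
    χ.mode i = χ'.mode i ∧ χ.τ i = χ'.τ i ∧ χ.τ (i + 1) ≤ χ'.τ (i + 1) ∧
    χ.c i (χ.τ i).toReal = χ'.c i (χ.τ i).toReal ∧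
    ∀ t : ℝ, χ.τ i ≤ t → t < χ.τ (i + 1) → χ.c i t = χ'.c i t

end Arc

namespace HybridSystem

variable {Q : Type*} {n : ℕ}

/-- An execution that has no proper extension. -/
def IsMaximalExecution (H : HybridSystem Q n) (q₀ : Q) (x₀ : State n) (χ : Arc Q n) : Prop :=
  H.IsExecution q₀ x₀ χ ∧ ∀ χ', H.IsExecution q₀ x₀ χ' → χ.Le χ' → χ'.Le χ

/-- Zeno equilibria. -/
structure IsZenoEquilibrium (H : HybridSystem Q n) (z : Q → State n) : Prop where
  mem : ∀ q, z q ∈ H.D q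
  guard : ∀ e ∈ H.E, z e.1 ∈ H.G e
  reset : ∀ e ∈ H.E, H.φ e (z e.1) = z e.2
  field_ne_zero : ∀ q, H.f q (z q) ≠ 0

/-- From the state `x` in mode `q` the vector field has a solution that stays in the domain for a
positive time. -/
def CanFlow (H : HybridSystem Q n) (q : Q) (x : State n) : Prop :=
  ∃ T > 0, ∃ c : ℝ → State n, c 0 = x ∧ ContinuousOn c (Ico 0 T) ∧
    ∀ t ∈ Ioo 0 T, c t ∈ H.D q ∧ HasDerivAt c (H.f q (c t)) t

/-- Near `z`, every state of a domain can either jump or flow: no execution gets stuck there. -/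
def IsNonblockingNear (H : HybridSystem Q n) (z : Q → State n) : Prop :=
  ∀ q, ∀ᶠ x in 𝓝[H.D q] (z q), (∃ e ∈ H.E, e.1 = q ∧ x ∈ H.G e) ∨ H.CanFlow q x

/-- `z` is Zeno stable: there are neighbourhoods `Z q` of the `z q` such that, for every initial
condition `(q, x)` with `x ∈ Z q ∩ D q`, the complete executions from `(q, x)` are Zeno and converge
to `z`, and such that, if no execution gets stuck near `z`, there really is a Zeno execution from
`(q, x)`, and all maximal executions from `(q, x)` are Zeno and converge to `z`. -/
def IsZenoStable (H : HybridSystem Q n) (z : Q → State n) : Prop :=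
  ∃ Z : Q → Set (State n), (∀ q, Z q ∈ 𝓝 (z q)) ∧ ∀ q, ∀ x ∈ Z q ∩ H.D q,
    (∀ χ, H.IsExecution q x χ → χ.IsComplete → χ.IsZeno ∧ χ.ConvergesTo z) ∧
    (H.IsNonblockingNear z →
      (∃ χ, H.IsExecution q x χ ∧ χ.IsZeno) ∧
      ∀ χ, H.IsMaximalExecution q x χ → χ.IsZeno ∧ χ.ConvergesTo z)

end HybridSystem

/-- Real polynomials in `(x, p)`, with `x ∈ ℝⁿ` and `p` in `ℝᵐ`. -/
abbrev Poly (n m : ℕ) : Type := MvPolynomial (Fin n ⊕ Fin m) ℝ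

/-- The value of a polynomial at `(x, p)`. -/
def Poly.val {n m : ℕ} (a : Poly n m) (x : State n) (p : Fin m → ℝ) : ℝ :=
  MvPolynomial.eval (Sum.elim (fun j => x j) p) a

/-- The polynomial data of a family of hybrid systems with a parameter `p ∈ ℝᵐ`. -/
structure UncertainModel (Q : Type*) (n m : ℕ) where
  /-- edges -/
  E : Set (Q × Q)
  /-- number of inequalities that define the parameter set -/
  numπ : ℕ
  /-- the polynomials that define the parameter set -/
  π : Fin numπ → MvPolynomial (Fin m) ℝ
  /-- number of inequalities that define a domain -/
  numg : Q → ℕ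
  /-- the polynomials that define the domains -/
  g : (q : Q) → Fin (numg q) → Poly n m
  /-- number of inequalities that define a guard -/
  numh : Q × Q → ℕ
  /-- the polynomials of the guard equations -/
  h₀ : Q × Q → Poly n m
  /-- the polynomials of the guard inequalities -/
  h : (e : Q × Q) → Fin (numh e) → Poly n m
  /-- components of the vector fields -/
  f : Q → Fin n → Poly n m
  /-- components of the reset maps -/
  φ : Q × Q → Fin n → Poly n m

namespace UncertainModel

variable {Q : Type*} {n m : ℕ}

/-- The parameter set. -/
def P (M : UncertainModel Q n m) : Set (Fin m → ℝ) :=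
  {p | ∀ k, 0 ≤ MvPolynomial.eval p (M.π k)}

/-- The domains. -/
def D (M : UncertainModel Q n m) (p : Fin m → ℝ) (q : Q) : Set (State n) :=
  {x | ∀ k, 0 ≤ (M.g q k).val x p}

/-- The guards. -/
def G (M : UncertainModel Q n m) (p : Fin m → ℝ) (e : Q × Q) : Set (State n) :=
  {x | x ∈ M.D p e.1 ∧ (M.h₀ e).val x p = 0 ∧ ∀ k, 0 ≤ (M.h e k).val x p}

/-- The vector fields. -/
def field (M : UncertainModel Q n m) (p : Fin m → ℝ) (q : Q) (x : State n) : State n :=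
  WithLp.toLp 2 fun j => (M.f q j).val x p

/-- The reset maps. -/
def resetMap (M : UncertainModel Q n m) (p : Fin m → ℝ) (e : Q × Q) (x : State n) : State n :=
  WithLp.toLp 2 fun j => (M.φ e j).val x p

/-- For every admissible parameter, the reset maps take the guards into the domains. -/
def IsWellDefined (M : UncertainModel Q n m) : Prop :=
  ∀ p ∈ M.P, ∀ e ∈ M.E, MapsTo (M.resetMap p e) (M.G p e) (M.D p e.2)

/-- The hybrid system `H(p)`. -/
def system (M : UncertainModel Q n m) (hM : M.IsWellDefined) (p : Fin m → ℝ) (hp : p ∈ M.P) :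
    HybridSystem Q n where
  E := M.E
  D := M.D p
  f := M.field p
  G := M.G p
  φ := M.resetMap p
  guard_subset := fun _ _ _ hx => hx.1
  reset_mapsTo := hM p hp

/-- The polynomial `xᵀ x`. -/
def sqNorm (n m : ℕ) : Poly n m := ∑ j, MvPolynomial.X (Sum.inl j) ^ 2

/-- The polynomial `∇ₓ Vᵀ f`, for a polynomial `V` and the vector field of the mode `q`. -/
def lieDeriv (M : UncertainModel Q n m) (q : Q) (V : Poly n m) : Poly n m :=
  ∑ j, MvPolynomial.pderiv (Sum.inl j) V * M.f q j

/-- The polynomial `V(φ(x, p), p)`, for a polynomial `V` and the reset map of the edge `e`. -/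
def compReset (M : UncertainModel Q n m) (e : Q × Q) (V : Poly n m) : Poly n m :=
  MvPolynomial.bind₁ (Sum.elim (M.φ e) fun k => MvPolynomial.X (Sum.inr k)) V

/-- A polynomial in `x`, as a polynomial in `(x, p)`. -/
def liftX (w : MvPolynomial (Fin n) ℝ) : Poly n m := MvPolynomial.rename Sum.inl w

/-- A polynomial in `p`, as a polynomial in `(x, p)`. -/
def liftP (w : MvPolynomial (Fin m) ℝ) : Poly n m := MvPolynomial.rename Sum.inr w

/-- A solution of the sum-of-squares feasibility problem for the family `M`, the points `z q` and
the sets `W q = {x | ∀ k, 0 < w q k x}`. -/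
structure SOSSolution (M : UncertainModel Q n m) (z : Q → State n) {numw : Q → ℕ}
    (w : (q : Q) → Fin (numw q) → MvPolynomial (Fin n) ℝ) where
  a : (q : Q) → Fin (numw q) → Poly n m
  c : (q : Q) → Fin (numw q) → Poly n m
  i : (q : Q) → Fin (numw q) → Poly n m
  b : (q : Q) → Fin (M.numg q) → Poly n m
  d : (q : Q) → Fin (M.numg q) → Poly n m
  j : (q : Q) → Fin (M.numg q) → Poly n m
  η : Q → Fin M.numπ → Poly n m
  β : Q → Fin M.numπ → Poly n m
  ζ : Q → Fin M.numπ → Poly n m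
  mult : (e : Q × Q) → Fin (M.numh e) → Poly n m
  mult₀ : Q × Q → Poly n m
  V : Q → Poly n m
  α : ℝ
  γ : ℝ
  r : Q → ℝ
  sos_a : ∀ q k, IsSumSq (a q k)
  sos_c : ∀ q k, IsSumSq (c q k)
  sos_i : ∀ q k, IsSumSq (i q k)
  sos_b : ∀ q k, IsSumSq (b q k)
  sos_d : ∀ q k, IsSumSq (d q k)
  sos_j : ∀ q k, IsSumSq (j q k)
  sos_η : ∀ q k, IsSumSq (η q k)
  sos_β : ∀ q k, IsSumSq (β q k)
  sos_ζ : ∀ q k, IsSumSq (ζ q k)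
  sos_mult : ∀ e ∈ M.E, ∀ l, IsSumSq (mult e l)
  α_pos : 0 < α
  γ_pos : 0 < γ
  r_pos : ∀ q, 0 < r q
  r_le_one : ∀ q, r q ≤ 1
  r_lt_one : ∃ q, r q < 1
  positivity : ∀ q, IsSumSq (V q - MvPolynomial.C α * sqNorm n m
    - ∑ k, a q k * liftX (w q k) - ∑ k, b q k * M.g q k - ∑ k, η q k * liftP (M.π k))
  vanishing : ∀ q, ∀ p ∈ M.P, (V q).val (z q) p = 0
  decrease : ∀ q, IsSumSq (-M.lieDeriv q (V q) - MvPolynomial.C γ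
    - ∑ k, c q k * liftX (w q k) - ∑ k, d q k * M.g q k - ∑ k, β q k * liftP (M.π k))
  jump : ∀ e ∈ M.E, IsSumSq (MvPolynomial.C (r e.1) * V e.1 - M.compReset e (V e.2)
    - mult₀ e * M.h₀ e - ∑ l, mult e l * M.h e l
    - ∑ k, i e.1 k * liftX (w e.1 k) - ∑ k, j e.1 k * M.g e.1 k
    - ∑ k, ζ e.1 k * liftP (M.π k))

end UncertainModel

end ZenoSOS

end

/-! The sum-of-squares identities are pointwise inequalities in disguise. Where all `w`, `g` and `π`
are nonnegative the multiplier terms have a sign, so on `W q ∩ D q` one gets `V_q ≥ α‖x‖²`, a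
derivative of `V_q` along the field of at most `-γ`, and `V_q' ∘ φ_e ≤ r_q V_q` on guards. As `V_q`
vanishes at `z q`, the first inequality forces `z q = 0`. Thus the `V_q` form a Lyapunov certificate
at the origin (`IsLyapunov`), valid on a ball common to all modes.

The set `V_q < α ρ₁²` is a trap: a curve leaving it would first reach norm `ρ₁`, where `V_q ≥ α
ρ₁²`, although `V_q` has only decreased (`flow_mem_sublevel`). Jumps keep the trap too, since `r_q ≤
1`. Hence `V + γ t` never increases along an execution, and `V ≥ 0` bounds all times by `V(x₀)/γ`. A
complete execution therefore jumps infinitely often in finite time. In a cyclic system it meets a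
mode with `r_q < 1` in every window of fixed length, so `V` tends to `0`, and by the lower bound so
does the state (`convergesTo_zero`).

In the non-blocking case a flow in the trap has a limit at the end of its interval, still in the
trap, from which it can jump or flow on. So an execution that is not complete has a proper
extension, and a maximal flow ends in a guard, which yields an infinite execution by iteration. -/

namespace ZenoSOS

namespace HybridSystem

variable {Q : Type*} {n : ℕ}

/-! ### Flows, Lyapunov certificates and the gluing of solutions -/

/-- The curve `c` solves the differential equation of the mode `q` on `[a, b)` and stays in the
domain on `(a, b)`. -/
structure IsFlow (H : HybridSystem Q n) (q : Q) (c : ℝ → State n) (a b : ℝ) : Prop where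
  cont : ContinuousOn c (Ico a b)
  deriv : ∀ t ∈ Ioo a b, HasDerivAt c (H.f q (c t)) t
  mem : ∀ t ∈ Ioo a b, c t ∈ H.D q

/-- The functions `v q` form a Lyapunov certificate for the Zeno equilibrium `0`: on the ball of
radius `ρ` they dominate `α * ‖x‖ ^ 2`, decrease at rate `γ` along the vector fields, and are
contracted by `r` under the resets. The radius `ρ₁` is such that resets of guard states of norm less
than `ρ₁` have norm at most `ρ`. -/
structure IsLyapunov (H : HybridSystem Q n) (v : Q → State n → ℝ) (α γ : ℝ) (r : Q → ℝ)
    (ρ ρ₁ : ℝ) : Prop where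
  α_pos : 0 < α
  γ_pos : 0 < γ
  r_nonneg : ∀ q, 0 ≤ r q
  r_le_one : ∀ q, r q ≤ 1
  r_lt_one : ∃ q, r q < 1
  radius_pos : 0 < ρ₁
  radius_le : ρ₁ ≤ ρ
  isClosed_domain : ∀ q, IsClosed (H.D q)
  continuous_field : ∀ q, Continuous (H.f q)
  differentiable : ∀ q, Differentiable ℝ (v q)
  apply_zero : ∀ q, v q 0 = 0
  lower : ∀ q, ∀ x ∈ H.D q, ‖x‖ ≤ ρ → α * ‖x‖ ^ 2 ≤ v q x
  decrease : ∀ q, ∀ x ∈ H.D q, ‖x‖ ≤ ρ → fderiv ℝ (v q) x (H.f q x) ≤ -γ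
  jump : ∀ e ∈ H.E, ∀ x ∈ H.G e, ‖x‖ ≤ ρ → v e.2 (H.φ e x) ≤ r e.1 * v e.1 x
  reset_norm : ∀ e ∈ H.E, ∀ x ∈ H.G e, ‖x‖ < ρ₁ → ‖H.φ e x‖ ≤ ρ

/-- The states of the domain `D q` in the ball of radius `ρ` where `v q` is less than
`α * ρ₁ ^ 2`. -/
def sublevel (H : HybridSystem Q n) (v : Q → State n → ℝ) (α ρ ρ₁ : ℝ) (q : Q) : Set (State n) :=
  {x | x ∈ H.D q ∧ ‖x‖ ≤ ρ ∧ v q x < α * ρ₁ ^ 2}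

/-- No state of a sublevel set is stuck. -/
def IsNonblockingOn (H : HybridSystem Q n) (v : Q → State n → ℝ) (α ρ ρ₁ : ℝ) : Prop :=
  ∀ q, ∀ x ∈ H.sublevel v α ρ ρ₁ q, (∃ e ∈ H.E, e.1 = q ∧ x ∈ H.G e) ∨ H.CanFlow q x

variable {H : HybridSystem Q n}

theorem IsFlow.mono {q : Q} {c : ℝ → State n} {a b b' : ℝ} (h : H.IsFlow q c a b) (hb : b' ≤ b) :
    H.IsFlow q c a b' :=
  ⟨h.cont.mono (Ico_subset_Ico_right hb), fun t ht => h.deriv t ⟨ht.1, ht.2.trans_le hb⟩,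
    fun t ht => h.mem t ⟨ht.1, ht.2.trans_le hb⟩⟩

theorem IsFlow.congr {q : Q} {c d : ℝ → State n} {a b : ℝ} (h : H.IsFlow q c a b)
    (hd : ∀ t ∈ Ico a b, d t = c t) : H.IsFlow q d a b := by
  refine ⟨h.cont.congr hd, fun t ht => ?_, fun t ht => ?_⟩
  · rw [hd t ⟨ht.1.le, ht.2⟩]
    refine (h.deriv t ht).congr_of_eventuallyEq ?_
    filter_upwards [Ioo_mem_nhds ht.1 ht.2] with s hs using hd s ⟨hs.1.le, hs.2⟩
  · rw [hd t ⟨ht.1.le, ht.2⟩]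
    exact h.mem t ht

theorem IsFlow.comp_sub {q : Q} {c : ℝ → State n} {a b : ℝ} (h : H.IsFlow q c a b) (s : ℝ) :
    H.IsFlow q (fun t => c (t - s)) (a + s) (b + s) := by
  refine ⟨h.cont.comp (by fun_prop) fun t ht => ⟨by linarith [ht.1], by linarith [ht.2]⟩,
    fun t ht => ?_, fun t ht => h.mem (t - s) ⟨by linarith [ht.1], by linarith [ht.2]⟩⟩
  exact (h.deriv (t - s) ⟨by linarith [ht.1], by linarith [ht.2]⟩).comp_sub_const t s

/-- Two flows that fit together can be joined. -/
theorem IsFlow.join {q : Q} {c d : ℝ → State n} {a b b' : ℝ} (hf : Continuous (H.f q))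
    (hab : a ≤ b) (hbb : b < b') (hc : H.IsFlow q c a b) (hcc : ContinuousOn c (Icc a b))
    (hd : H.IsFlow q d b b') (hcd : d b = c b) (hD : c b ∈ H.D q) :
    H.IsFlow q (fun t => if t < b then c t else d t) a b' := by
  set k : ℝ → State n := fun t => if t < b then c t else d t with hk
  have kd : ∀ t, b ≤ t → k t = d t := fun t ht => if_neg ht.not_gt
  have kc : ∀ t, t ≤ b → k t = c t := fun t ht => by
    rcases ht.lt_or_eq with h | rfl
    · exact if_pos h
    · rw [kd _ le_rfl, hcd]
  have k1 : ContinuousOn k (Icc a b) := hcc.congr fun t ht => kc t ht.2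
  have k2 : ContinuousOn k (Ico b b') := hd.cont.congr fun t ht => kd t ht.1
  have kcont : ContinuousOn k (Ico a b') := by
    intro t ht
    have e : Ico a b' = Icc a b ∪ Ico b b' := (Icc_union_Ico_eq_Ico hab hbb).symm
    rw [e]
    refine ContinuousWithinAt.union ?_ ?_
    · by_cases h : t ≤ b
      · exact k1 t ⟨ht.1, h⟩
      · exact continuousWithinAt_of_notMem_closure fun h' =>
          h (by rw [isClosed_Icc.closure_eq] at h'; exact h'.2)
    · by_cases h : b ≤ t
      · exact k2 t ⟨h, ht.2⟩
      · refine continuousWithinAt_of_notMem_closure fun h' => h ?_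
        exact (closure_minimal (fun x hx => hx.1) isClosed_Ici : closure (Ico b b') ⊆ Ici b) h'
  have dlt : ∀ t ∈ Ioo a b, HasDerivAt k (H.f q (k t)) t :=
    (hc.congr (d := k) fun t ht => kc t ht.2.le).deriv
  have dgt : ∀ t ∈ Ioo b b', HasDerivAt k (H.f q (k t)) t :=
    (hd.congr (d := k) fun t ht => kd t ht.1).deriv
  refine ⟨kcont, fun t ht => ?_, fun t ht => ?_⟩
  · rcases lt_trichotomy t b with h | rfl | h
    · exact dlt t ⟨ht.1, h⟩
    · have kt : ContinuousAt k t := kcont.continuousAt (Ico_mem_nhds ht.1 ht.2)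
      -- At the junction the derivatives on both sides converge to the value of the continuous
      -- field, so both one-sided derivatives exist and agree.
      have ft : Tendsto (fun s => H.f q (k s)) (𝓝 t) (𝓝 (H.f q (k t))) :=
        (hf.continuousAt.comp kt)
      have h1 : HasDerivWithinAt k (H.f q (k t)) (Iic t) t := by
        refine hasDerivWithinAt_Iic_of_tendsto_deriv (s := Ioo a t)
          (fun s hs => (dlt s hs).differentiableAt.differentiableWithinAt)
          kt.continuousWithinAt (Ioo_mem_nhdsLT ht.1) ?_
        refine (ft.mono_left nhdsWithin_le_nhds).congr' ?_
        filter_upwards [Ioo_mem_nhdsLT ht.1] with s hs using (dlt s hs).deriv.symm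
      have h2 : HasDerivWithinAt k (H.f q (k t)) (Ici t) t := by
        refine hasDerivWithinAt_Ici_of_tendsto_deriv (s := Ioo t b')
          (fun s hs => (dgt s hs).differentiableAt.differentiableWithinAt)
          kt.continuousWithinAt (Ioo_mem_nhdsGT ht.2) ?_
        refine (ft.mono_left nhdsWithin_le_nhds).congr' ?_
        filter_upwards [Ioo_mem_nhdsGT ht.2] with s hs using (dgt s hs).deriv.symm
      exact (h1.union h2).hasDerivAt (by rw [Iic_union_Ici]; exact univ_mem)
    · exact dgt t ⟨h, ht.2⟩
  · rcases lt_trichotomy t b with h | rfl | h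
    · rw [kc t h.le]; exact hc.mem t ⟨ht.1, h⟩
    · rw [kc t le_rfl]; exact hD
    · rw [kd t h.le]; exact hd.mem t ⟨h, ht.2⟩

theorem CanFlow.exists_isFlow {q : Q} {x : State n}
    (hx : H.CanFlow q x) (a : ℝ) : ∃ b > a, ∃ d : ℝ → State n, d a = x ∧ H.IsFlow q d a b := by
  obtain ⟨T, hT, c, hc0, hcc, hc⟩ := hx
  have hf : H.IsFlow q c 0 T := ⟨hcc, fun t ht => (hc t ht).2, fun t ht => (hc t ht).1⟩
  refine ⟨a + T, by linarith, fun t => c (t - a), by simpa using hc0, ?_⟩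
  have := hf.comp_sub a
  rwa [zero_add, add_comm T a] at this

/-! ### Flows inside the sublevel sets -/

namespace IsLyapunov

variable {v : Q → State n → ℝ} {α γ : ℝ} {r : Q → ℝ} {ρ ρ₁ : ℝ}

/-- The lower bound `α‖x‖² ≤ v` improves the built-in bound `ρ` to `ρ₁`; this gap between the two
radii is what makes the sublevel sets traps. -/
theorem norm_lt (h : H.IsLyapunov v α γ r ρ ρ₁) {q : Q} {x : State n}
    (hx : x ∈ H.sublevel v α ρ ρ₁ q) : ‖x‖ < ρ₁ := by
  have h1 := (h.lower q x hx.1 hx.2.1).trans_lt hx.2.2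
  have h2 := lt_of_mul_lt_mul_left h1 h.α_pos.le
  exact lt_of_pow_lt_pow_left₀ 2 h.radius_pos.le h2

theorem nonneg (h : H.IsLyapunov v α γ r ρ ρ₁) {q : Q} {x : State n}
    (hx : x ∈ H.sublevel v α ρ ρ₁ q) : 0 ≤ v q x :=
  le_trans (mul_nonneg h.α_pos.le (sq_nonneg _)) (h.lower q x hx.1 hx.2.1)

/-- Mean value inequality for `v q ∘ c`, with the norm bound still an assumption;
`flow_mem_sublevel` removes it. -/
theorem flow_decrease_of_norm_le (h : H.IsLyapunov v α γ r ρ ρ₁) {q : Q} {c : ℝ → State n}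
    {a b : ℝ} (hab : a ≤ b) (hc : H.IsFlow q c a b) (hcc : ContinuousOn c (Icc a b))
    (hn : ∀ t ∈ Ioo a b, ‖c t‖ ≤ ρ) : v q (c b) + γ * (b - a) ≤ v q (c a) := by
  have hd : ∀ t ∈ Ioo a b, HasDerivAt (fun s => v q (c s))
      (fderiv ℝ (v q) (c t) (H.f q (c t))) t := fun t ht =>
    ((h.differentiable q (c t)).hasFDerivAt).comp_hasDerivAt t (hc.deriv t ht)
  have := Convex.image_sub_le_mul_sub_of_deriv_le (convex_Icc a b) (f := fun s => v q (c s))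
    ((h.differentiable q).continuous.comp_continuousOn hcc)
    (by
      rw [interior_Icc]
      exact fun t ht => (hd t ht).differentiableAt.differentiableWithinAt)
    (C := -γ)
    (by
      rw [interior_Icc]
      intro t ht
      rw [(hd t ht).deriv]
      exact h.decrease q _ (hc.mem t ht) (hn t ht))
    a (left_mem_Icc.2 hab) b (right_mem_Icc.2 hab) hab
  linarith

theorem flow_mem_domain (h : H.IsLyapunov v α γ r ρ ρ₁) {q : Q} {c : ℝ → State n}
    {a b : ℝ} (hab : a ≤ b) (hc : H.IsFlow q c a b) (hcc : ContinuousOn c (Icc a b))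
    (ha : c a ∈ H.D q) : c b ∈ H.D q := by
  rcases hab.eq_or_lt with rfl | hab
  · exact ha
  · have h1 : Tendsto c (𝓝[Ioo a b] b) (𝓝 (c b)) :=
      (hcc b (right_mem_Icc.2 hab.le)).mono_left (nhdsWithin_mono _ Ioo_subset_Icc_self)
    have : (𝓝[Ioo a b] b).NeBot := by
      rw [nhdsWithin_Ioo_eq_nhdsLT hab]; infer_instance
    exact (h.isClosed_domain q).mem_of_tendsto h1
      (eventually_nhdsWithin_of_forall fun t ht => hc.mem t ht)

/-- The sublevel sets are invariant under the flow, on which `v` decreases at rate `γ`. -/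
theorem flow_mem_sublevel (h : H.IsLyapunov v α γ r ρ ρ₁) {q : Q} {c : ℝ → State n}
    {a b : ℝ} (hab : a ≤ b) (hc : H.IsFlow q c a b) (hcc : ContinuousOn c (Icc a b))
    (ha : c a ∈ H.sublevel v α ρ ρ₁ q) :
    c b ∈ H.sublevel v α ρ ρ₁ q ∧ v q (c b) + γ * (b - a) ≤ v q (c a) := by
  have hn : ∀ t ∈ Icc a b, ‖c t‖ < ρ₁ := by
    by_contra! hcon
    obtain ⟨t₁, ht₁, hρ⟩ := hcon
    -- Compactness provides the first time `s` at which the norm reaches `ρ₁`.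
    have hK : IsCompact (Icc a b ∩ (fun t => ‖c t‖) ⁻¹' Ici ρ₁) :=
      isCompact_Icc.of_isClosed_subset
        (hcc.norm.preimage_isClosed_of_isClosed isClosed_Icc isClosed_Ici) inter_subset_left
    obtain ⟨s, hs, hmin⟩ := hK.exists_isLeast ⟨t₁, ht₁, hρ⟩
    have hlt : ∀ t ∈ Ico a s, ‖c t‖ < ρ₁ := fun t ht => by
      by_contra! hge
      exact ht.2.not_ge (hmin ⟨⟨ht.1, ht.2.le.trans hs.1.2⟩, hge⟩)
    have has : a < s := by
      rcases hs.1.1.eq_or_lt with e | e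
      · exact absurd hs.2 (by rw [← e]; exact not_le.2 (h.norm_lt ha))
      · exact e
    have hcs : ContinuousOn c (Icc a s) := hcc.mono (Icc_subset_Icc_right hs.1.2)
    have hle : ‖c s‖ ≤ ρ₁ := by
      have h1 : Tendsto (fun t => ‖c t‖) (𝓝[Ioo a s] s) (𝓝 ‖c s‖) :=
        ((hcs s (right_mem_Icc.2 has.le)).mono_left
          (nhdsWithin_mono _ Ioo_subset_Icc_self)).norm
      have : (𝓝[Ioo a s] s).NeBot := by
        rw [nhdsWithin_Ioo_eq_nhdsLT has]; infer_instance
      exact le_of_tendsto h1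
        (eventually_nhdsWithin_of_forall fun t ht => (hlt t ⟨ht.1.le, ht.2⟩).le)
    have hv := h.flow_decrease_of_norm_le has.le (hc.mono hs.1.2) hcs
      fun t ht => (hlt t ⟨ht.1.le, ht.2⟩).le.trans h.radius_le
    have hD := h.flow_mem_domain has.le (hc.mono hs.1.2) hcs ha.1
    have hlow := h.lower q _ hD (hle.trans h.radius_le)
    -- Contradiction: `v` is at least `α ρ₁²` at time `s`, but started below that value and has
    -- decreased.
    have heq : ‖c s‖ = ρ₁ := le_antisymm hle hs.2
    rw [heq] at hlow
    have := mul_pos h.γ_pos (sub_pos.2 has)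
    linarith [ha.2.2]
  have hv := h.flow_decrease_of_norm_le hab hc hcc
    fun t ht => (hn t ⟨ht.1.le, ht.2.le⟩).le.trans h.radius_le
  refine ⟨⟨h.flow_mem_domain hab hc hcc ha.1,
    (hn b (right_mem_Icc.2 hab)).le.trans h.radius_le, ?_⟩, hv⟩
  have := mul_nonneg h.γ_pos.le (sub_nonneg.2 hab)
  linarith [ha.2.2]

theorem flow_mem_sublevel_of_mem_Ico (h : H.IsLyapunov v α γ r ρ ρ₁) {q : Q} {c : ℝ → State n}
    {a b : ℝ} (hc : H.IsFlow q c a b) (ha : c a ∈ H.sublevel v α ρ ρ₁ q) {t : ℝ}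
    (ht : t ∈ Ico a b) :
    c t ∈ H.sublevel v α ρ ρ₁ q ∧ v q (c t) + γ * (t - a) ≤ v q (c a) :=
  h.flow_mem_sublevel ht.1 (hc.mono ht.2.le)
    (hc.cont.mono fun _ hs => ⟨hs.1, hs.2.trans_lt ht.2⟩) ha

/-- A flow that starts in a sublevel set has a limit at the end of its interval. -/
theorem exists_flow_limit (h : H.IsLyapunov v α γ r ρ ρ₁) {q : Q} {c : ℝ → State n}
    {a b : ℝ} (hab : a ≤ b) (hc : H.IsFlow q c a b) (ha : c a ∈ H.sublevel v α ρ ρ₁ q) :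
    ∃ y, ContinuousOn (Function.update c b y) (Icc a b) ∧ Function.update c b y a = c a := by
  rcases hab.eq_or_lt with rfl | hab
  · exact ⟨c a, by simp⟩
  -- The field is bounded on the compact ball that contains the curve, so the curve is Lipschitz; a
  -- Lipschitz extension to the whole line supplies the limit.
  obtain ⟨K, hK⟩ := (isCompact_closedBall (0 : State n) ρ).exists_bound_of_continuousOn
    (h.continuous_field q).continuousOn
  have hlip : LipschitzOnWith K.toNNReal c (Ioo a b) := by
    refine (convex_Ioo a b).lipschitzOnWith_of_nnnorm_hasDerivWithin_le
      (fun t ht => (hc.deriv t ht).hasDerivWithinAt) fun t ht => ?_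
    have := hK (c t) (by
      simpa using (h.flow_mem_sublevel_of_mem_Ico hc ha ⟨ht.1.le, ht.2⟩).1.2.1)
    exact NNReal.coe_le_coe.1 (this.trans (Real.le_coe_toNNReal K))
  obtain ⟨g, hg, hcg⟩ := hlip.extend_finite_dimension
  refine ⟨g b, ?_, Function.update_of_ne hab.ne _ _⟩
  rw [continuousOn_update_iff, Icc_sdiff_right]
  refine ⟨hc.cont, fun _ => ?_⟩
  refine Tendsto.congr' ?_ (hg.continuous.continuousAt.mono_left nhdsWithin_le_nhds)
  filter_upwards [self_mem_nhdsWithin, mem_nhdsWithin_of_mem_nhds (Ioi_mem_nhds hab)] with t h1 h2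
  exact (hcg ⟨h2, h1.2⟩).symm

/-- A state of the trap has norm less than `ρ₁`, so its reset stays in the ball of radius `ρ`, where
the certificate is valid; `r ≤ 1` and `v ≥ 0` keep the level. -/
theorem reset_mem_sublevel (h : H.IsLyapunov v α γ r ρ ρ₁) {e : Q × Q} (he : e ∈ H.E)
    {x : State n} (hx : x ∈ H.sublevel v α ρ ρ₁ e.1) (hG : x ∈ H.G e) :
    H.φ e x ∈ H.sublevel v α ρ ρ₁ e.2 ∧ v e.2 (H.φ e x) ≤ r e.1 * v e.1 x := by
  have hj := h.jump e he x hG hx.2.1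
  refine ⟨⟨H.reset_mapsTo e he hG, h.reset_norm e he x hG (h.norm_lt hx), ?_⟩, hj⟩
  have := mul_le_mul_of_nonneg_right (h.r_le_one e.1) (h.nonneg hx)
  linarith [hx.2.2]

/-- From a state of a sublevel set the system can flow until it reaches a guard. -/
theorem exists_flow_to_guard (h : H.IsLyapunov v α γ r ρ ρ₁)
    (hnb : H.IsNonblockingOn v α ρ ρ₁) {q : Q} {x : State n} (hx : x ∈ H.sublevel v α ρ ρ₁ q) :
    ∃ T ≥ 0, ∃ c : ℝ → State n, c 0 = x ∧ H.IsFlow q c 0 T ∧ ContinuousOn c (Icc 0 T) ∧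
      ∃ e ∈ H.E, e.1 = q ∧ c T ∈ H.G e := by
  -- Zorn's lemma on flows from `x`, ordered by extension. Curves are compared only before the end
  -- time, so `R` is merely a preorder.
  let S : Type := {u : ℝ × (ℝ → State n) // 0 ≤ u.1 ∧ u.2 0 = x ∧ H.IsFlow q u.2 0 u.1}
  let R : S → S → Prop := fun s t => s.1.1 ≤ t.1.1 ∧ ∀ θ ∈ Ico 0 s.1.1, t.1.2 θ = s.1.2 θ
  have hbound : ∀ s : S, s.1.1 ≤ v q x / γ := by
    intro s
    refine le_of_forall_lt fun t ht => ?_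
    rcases lt_or_ge t 0 with h0 | h0
    · exact h0.trans_le (div_nonneg (h.nonneg hx) h.γ_pos.le)
    · obtain ⟨t', ht', ht''⟩ := exists_between ht
      have hx' : s.1.2 0 ∈ H.sublevel v α ρ ρ₁ q := by rw [s.2.2.1]; exact hx
      have h1 := h.flow_mem_sublevel_of_mem_Ico s.2.2.2 hx' ⟨h0.trans ht'.le, ht''⟩
      refine ht'.trans_le ?_
      rw [le_div_iff₀ h.γ_pos]
      have h2 := h1.2
      rw [s.2.2.1] at h2
      have h3 := h.nonneg h1.1
      linarith
  obtain ⟨s, hs⟩ : ∃ s : S, ∀ t, R s t → R t s := by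
    refine exists_maximal_of_chains_bounded (r := R) ?_ ?_
    · intro C hC
      rcases C.eq_empty_or_nonempty with rfl | hne
      · refine ⟨⟨(0, fun _ => x), le_rfl, rfl, ?_, ?_, ?_⟩, by simp⟩ <;> simp
      have hbdd : BddAbove ((fun s : S => s.1.1) '' C) :=
        ⟨v q x / γ, by rintro _ ⟨s, -, rfl⟩; exact hbound s⟩
      have hne' := hne.image (fun s : S => s.1.1)
      set T := sSup ((fun s : S => s.1.1) '' C) with hT
      have hlt : ∀ t < T, ∃ s ∈ C, t < s.1.1 := fun t ht => by
        obtain ⟨_, ⟨s, hs, rfl⟩, h2⟩ := exists_lt_of_lt_csSup hne' ht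
        exact ⟨s, hs, h2⟩
      have : Nonempty S := ⟨hne.some⟩
      choose! g hgC hg using hlt
      have hagree : ∀ s ∈ C, ∀ s' ∈ C, ∀ t, 0 ≤ t → t < s.1.1 → t < s'.1.1 →
          s.1.2 t = s'.1.2 t := by
        intro s hs s' hs' t h0 h1 h2
        by_cases hss : s = s'
        · rw [hss]
        rcases hC hs hs' hss with hr | hr
        · exact (hr.2 t ⟨h0, h1⟩).symm
        · exact hr.2 t ⟨h0, h2⟩
      -- The union of the chain; the default `x` gives the right initial value when `T = 0`.
      let k : ℝ → State n := fun t => if t < T then (g t).1.2 t else x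
      have hkT : ∀ s ∈ C, s.1.1 ≤ T := fun s hs => le_csSup hbdd ⟨s, hs, rfl⟩
      have hk : ∀ s ∈ C, ∀ t ∈ Ico 0 s.1.1, k t = s.1.2 t := by
        intro s hs t ht
        have htT := ht.2.trans_le (hkT s hs)
        simp only [k, if_pos htT]
        exact hagree _ (hgC t htT) _ hs t ht.1 (hg t htT) ht.2
      have hflow : ∀ s ∈ C, H.IsFlow q k 0 s.1.1 := fun s hs => s.2.2.2.congr (hk s hs)
      obtain ⟨s₀, hs₀⟩ := hne
      have hT0 : 0 ≤ T := s₀.2.1.trans (hkT s₀ hs₀)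
      refine ⟨⟨(T, k), hT0, ?_, ?_, ?_, ?_⟩, fun s hs => ⟨hkT s hs, hk s hs⟩⟩
      · by_cases h0 : (0 : ℝ) < T
        · simp only [k, if_pos h0]
          exact (g 0).2.2.1
        · simp only [k, if_neg h0]
      · intro t ht
        have h1 := (hflow _ (hgC t ht.2)).cont t ⟨ht.1, hg t ht.2⟩
        refine h1.mono_of_mem_nhdsWithin ?_
        filter_upwards [self_mem_nhdsWithin,
          mem_nhdsWithin_of_mem_nhds (Iio_mem_nhds (hg t ht.2))] with θ h2 h3
        exact ⟨h2.1, h3⟩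
      · intro t ht
        exact (hflow _ (hgC t ht.2)).deriv t ⟨ht.1, hg t ht.2⟩
      · intro t ht
        exact (hflow _ (hgC t ht.2)).mem t ⟨ht.1, hg t ht.2⟩
    · intro s t u h1 h2
      refine ⟨h1.1.trans h2.1, fun θ hθ => ?_⟩
      rw [h2.2 θ ⟨hθ.1, hθ.2.trans_le h1.1⟩, h1.2 θ hθ]
  obtain ⟨⟨T, c⟩, hT0, hc0, hc⟩ := s
  dsimp only at hT0 hc0 hc
  have hx' : c 0 ∈ H.sublevel v α ρ ρ₁ q := by rw [hc0]; exact hx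
  obtain ⟨y, hy, hy0⟩ := h.exists_flow_limit hT0 hc hx'
  have hupd : ∀ t ∈ Ico 0 T, Function.update c T y t = c t := fun t ht =>
    Function.update_of_ne ht.2.ne _ _
  have hc' : H.IsFlow q (Function.update c T y) 0 T := hc.congr hupd
  have hyT := (h.flow_mem_sublevel hT0 hc' hy (by rw [hy0]; exact hx')).1
  refine ⟨T, hT0, Function.update c T y, hy0.trans hc0, hc', hy, ?_⟩
  -- If the limit state could flow, the joined curve would be a longer flow, against maximality; so
  -- it lies in a guard.
  rcases hnb q _ hyT with hj | hf
  · exact hj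
  · exfalso
    obtain ⟨b, hb, d, hd0, hd⟩ := hf.exists_isFlow T
    have hjoin := hc'.join (h.continuous_field q) hT0 hb hy hd hd0 hyT.1
    have hcT : ∀ t ∈ Ico 0 T, (if t < T then Function.update c T y t else d t) = c t :=
      fun t ht => (if_pos ht.2).trans (hupd t ht)
    have hk0 : (if (0 : ℝ) < T then Function.update c T y 0 else d 0) = x := by
      rcases hT0.eq_or_lt with rfl | h0
      · rw [if_neg (lt_irrefl _), hd0, hy0, hc0]
      · rw [if_pos h0, hy0, hc0]
    exact (hs ⟨(b, _), hT0.trans hb.le, hk0, hjoin⟩ ⟨hb.le, hcT⟩).1.not_gt hb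

end IsLyapunov

end HybridSystem

/-! ### Recurrence of modes and contraction -/

/-- In a cyclic system every mode is visited in every window of a fixed length. -/
theorem HybridSystem.IsCyclic.exists_visit {Q : Type*} [Finite Q] {n : ℕ} {H : HybridSystem Q n}
    (hH : H.IsCyclic) : ∃ K : ℕ, ∀ s : ℕ → Q, (∀ i, (s i, s (i + 1)) ∈ H.E) →
      ∀ q i, ∃ j, i ≤ j ∧ j < i + K ∧ s j = q := by
  have hsrc : ∀ q, ∃ q', (q, q') ∈ H.E := fun q => by
    obtain ⟨⟨q₁, q₂⟩, ⟨he, rfl⟩, -⟩ := hH.source q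
    exact ⟨q₂, he⟩
  choose σ hσ using hsrc
  have huniq : ∀ q q', (q, q') ∈ H.E → q' = σ q := fun q q' he =>
    congrArg Prod.snd ((hH.source q).unique ⟨he, rfl⟩ ⟨hσ q, rfl⟩)
  have hinj : Function.Injective σ := fun a b hab =>
    congrArg Prod.fst ((hH.target (σ a)).unique ⟨hσ a, rfl⟩ ⟨hσ b, hab.symm⟩)
  -- The successor map is a permutation, and connectedness makes it a single cycle; its order serves
  -- as window length.
  let f : Equiv.Perm Q := Equiv.ofBijective σ (Finite.injective_iff_bijective.1 hinj)
  have hcyc : ∀ a b, f.SameCycle a b := fun a b => by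
    induction hH.connected a b with
    | rel u v huv =>
      rw [huniq u v huv]
      exact ⟨1, by simp [f]⟩
    | refl u => exact .refl _ _
    | symm u v _ ih => exact ih.symm
    | trans u v w _ _ ih₁ ih₂ => exact ih₁.trans ih₂
  refine ⟨orderOf f, fun s hs q i => ?_⟩
  obtain ⟨k, hk, hkq⟩ := (hcyc (s i) q).exists_pow_eq'
  refine ⟨i + k, by omega, by omega, ?_⟩
  rw [← hkq]
  clear hkq hk
  induction k with
  | zero => simp
  | succ k ih =>
    rw [← add_assoc, huniq _ _ (hs (i + k)), ih, pow_succ']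
    rfl

/-- An antitone nonnegative sequence that is contracted over every window of a fixed length tends
to zero. -/
theorem tendsto_zero_of_contraction {u : ℕ → ℝ} (hu : Antitone u) (h0 : ∀ i, 0 ≤ u i) {K : ℕ}
    {s : ℝ} (hs : s < 1) (hK : ∀ i, u (i + K) ≤ s * u i) : Tendsto u atTop (𝓝 0) := by
  have h1 : Tendsto u atTop (𝓝 (⨅ i, u i)) :=
    tendsto_atTop_ciInf hu ⟨0, by rintro _ ⟨i, rfl⟩; exact h0 i⟩
  have h2 : 0 ≤ ⨅ i, u i := le_ciInf h0
  -- Passing to the limit `L` in the contraction gives `L ≤ s * L` with `s < 1` and `L ≥ 0`.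
  have h3 : (⨅ i, u i) ≤ s * ⨅ i, u i :=
    le_of_tendsto_of_tendsto' (h1.comp (tendsto_add_atTop_nat K)) (h1.const_mul s) hK
  have h4 : (⨅ i, u i) = 0 := by nlinarith
  rwa [h4] at h1

theorem Arc.Le.trans {Q : Type*} {n : ℕ} {χ₁ χ₂ χ₃ : Arc Q n} (h : χ₁.Le χ₂) (h' : χ₂.Le χ₃) :
    χ₁.Le χ₃ := by
  refine ⟨h.1.trans h'.1, fun i hi => ?_⟩
  obtain ⟨a1, a2, a3, a4, a5⟩ := h.2 i hi
  obtain ⟨b1, b2, b3, b4, b5⟩ := h'.2 i (h.1 hi)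
  refine ⟨a1.trans b1, a2.trans b2, a3.trans b3, ?_, fun t h1 h2 => ?_⟩
  · rw [a4, a2, b4]
  · rw [a5 t h1 h2, b5 t (a2 ▸ h1) (h2.trans_le a3)]

/-! ### Modifying and extending executions -/

namespace HybridSystem

variable {Q : Type*} {n : ℕ} {H : HybridSystem Q n}

namespace IsExecution

variable {q₀ : Q} {x₀ : State n} {χ : Arc Q n}

theorem mem_of_le (hχ : H.IsExecution q₀ x₀ χ) {i j : ℕ} (hij : i ≤ j) (hj : j ∈ χ.I) :
    i ∈ χ.I :=
  Nat.decreasingInduction (fun k _ hk => hχ.mem_of_succ_mem k hk) hj hij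

theorem time_nonneg (hχ : H.IsExecution q₀ x₀ χ) : ∀ i ∈ χ.I, 0 ≤ χ.τ i
  | 0, _ => hχ.time_zero.ge
  | i + 1, hi =>
    have hi' := hχ.mem_of_succ_mem i hi
    (hχ.time_nonneg i hi').trans (hχ.time_le i hi')

theorem coe_toReal_time (hχ : H.IsExecution q₀ x₀ χ) {i : ℕ} (hi : i ∈ χ.I) :
    ((χ.τ i).toReal : EReal) = χ.τ i :=
  EReal.coe_toReal (hχ.time_ne_top i hi)
    (ne_of_gt (lt_of_lt_of_le EReal.bot_lt_zero (hχ.time_nonneg i hi)))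

theorem isFlow (hχ : H.IsExecution q₀ x₀ χ) {i : ℕ} (hi : i ∈ χ.I) {b : ℝ}
    (hb : (b : EReal) ≤ χ.τ (i + 1)) : H.IsFlow (χ.mode i) (χ.c i) (χ.τ i).toReal b := by
  have ha := hχ.coe_toReal_time hi
  have h1 : ∀ t, (χ.τ i).toReal ≤ t → χ.τ i ≤ (t : EReal) := fun t ht => by
    rw [← ha]; exact EReal.coe_le_coe_iff.2 ht
  have h2 : ∀ t, (χ.τ i).toReal < t → χ.τ i < (t : EReal) := fun t ht => by
    rw [← ha]; exact EReal.coe_lt_coe_iff.2 ht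
  have h3 : ∀ t, t < b → (t : EReal) < χ.τ (i + 1) := fun t ht =>
    (EReal.coe_lt_coe_iff.2 ht).trans_le hb
  exact ⟨(hχ.continuous i hi).mono fun t ht => ⟨h1 t ht.1, h3 t ht.2⟩,
    fun t ht => hχ.flow i hi t (h2 t ht.1) (h3 t ht.2),
    fun t ht => hχ.domain i hi t (h2 t ht.1) (h3 t ht.2)⟩

theorem continuousOn_Icc (hχ : H.IsExecution q₀ x₀ χ) {i : ℕ} (hi : i + 1 ∈ χ.I) :
    ContinuousOn (χ.c i) (Icc (χ.τ i).toReal (χ.τ (i + 1)).toReal) := by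
  refine (hχ.continuous_end i hi).mono fun t ht => ?_
  rw [mem_ofPred_eq, ← hχ.coe_toReal_time hi, ← hχ.coe_toReal_time (hχ.mem_of_succ_mem i hi)]
  exact ⟨EReal.coe_le_coe_iff.2 ht.1, EReal.coe_le_coe_iff.2 ht.2⟩

theorem toReal_time_le (hχ : H.IsExecution q₀ x₀ χ) {i : ℕ} (hi : i + 1 ∈ χ.I) :
    (χ.τ i).toReal ≤ (χ.τ (i + 1)).toReal := by
  have hi' := hχ.mem_of_succ_mem i hi
  have := hχ.time_le i hi'
  rwa [← hχ.coe_toReal_time hi, ← hχ.coe_toReal_time hi', EReal.coe_le_coe_iff] at this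

/-- Replace the last interval of an execution. -/
theorem replace_last (hχ : H.IsExecution q₀ x₀ χ) {N : ℕ} (hN : N ∈ χ.I) (hN' : N + 1 ∉ χ.I)
    {k : ℝ → State n} {b : ℝ} (hb : (χ.τ N).toReal ≤ b)
    (hk0 : k (χ.τ N).toReal = χ.c N (χ.τ N).toReal)
    (hk : H.IsFlow (χ.mode N) k (χ.τ N).toReal b) :
    H.IsExecution q₀ x₀ { χ with
      τ := Function.update χ.τ (N + 1) b
      c := Function.update χ.c N k } := by
  have hle : ∀ i ∈ χ.I, i ≤ N := fun i hi => by
    by_contra! h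
    exact hN' (hχ.mem_of_le h hi)
  have hτ : ∀ i ∈ χ.I, Function.update χ.τ (N + 1) (b : EReal) i = χ.τ i := fun i hi =>
    Function.update_of_ne (by have := hle i hi; omega) _ _
  have hτ' : ∀ i, i + 1 ∈ χ.I →
      Function.update χ.τ (N + 1) (b : EReal) (i + 1) = χ.τ (i + 1) := fun i hi => hτ _ hi
  have hc : ∀ i, i + 1 ∈ χ.I → Function.update χ.c N k i = χ.c i := fun i hi =>
    Function.update_of_ne (by have := hle _ hi; omega) _ _
  have hstart : ∀ i ∈ χ.I, Function.update χ.c N k i (χ.τ i).toReal = χ.c i (χ.τ i).toReal := by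
    intro i hi
    by_cases h : i = N
    · subst h; simpa using hk0
    · rw [Function.update_of_ne h]
  have hcoe := hχ.coe_toReal_time hN
  have hset : ∀ {t : ℝ}, χ.τ N ≤ t → (t : EReal) < b → t ∈ Ico (χ.τ N).toReal b :=
    fun h1 h2 => ⟨by rwa [← hcoe, EReal.coe_le_coe_iff] at h1, EReal.coe_lt_coe_iff.1 h2⟩
  have hset' : ∀ {t : ℝ}, χ.τ N < t → (t : EReal) < b → t ∈ Ioo (χ.τ N).toReal b :=
    fun h1 h2 => ⟨by rwa [← hcoe, EReal.coe_lt_coe_iff] at h1, EReal.coe_lt_coe_iff.1 h2⟩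
  have hlt : ∀ i ∈ χ.I, i ≠ N → i + 1 ∈ χ.I := fun i hi hne =>
    hχ.mem_of_le (by have := hle i hi; omega) hN
  constructor
  · exact hχ.zero_mem
  · exact hχ.mem_of_succ_mem
  · exact (hτ 0 hχ.zero_mem).trans hχ.time_zero
  · intro i hi
    dsimp only
    rw [hτ i hi]
    exact hχ.time_ne_top i hi
  · intro i hi
    dsimp only
    rw [hτ i hi]
    by_cases h : i = N
    · subst h
      rw [Function.update_self, ← hcoe]
      exact EReal.coe_le_coe_iff.2 hb
    · rw [hτ' i (hlt i hi h)]
      exact hχ.time_le i hi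
  · exact hχ.init_mode
  · have := hstart 0 hχ.zero_mem
    rw [hχ.time_zero, EReal.toReal_zero] at this
    exact this.trans hχ.init_state
  · intro i hi
    dsimp only
    rw [hτ i hi]
    by_cases h : i = N
    · subst h
      rw [Function.update_self, Function.update_self]
      exact hk.cont.mono fun t ht => hset ht.1 ht.2
    · rw [hτ' i (hlt i hi h), hc i (hlt i hi h)]
      exact hχ.continuous i hi
  · intro i hi
    dsimp only
    rw [hτ i (hχ.mem_of_succ_mem i hi), hτ' i hi, hc i hi]
    exact hχ.continuous_end i hi
  · intro i hi
    dsimp only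
    rw [hτ i hi]
    by_cases h : i = N
    · subst h
      rw [Function.update_self, Function.update_self]
      exact fun t h1 h2 => hk.deriv t (hset' h1 h2)
    · rw [hτ' i (hlt i hi h), hc i (hlt i hi h)]
      exact hχ.flow i hi
  · intro i hi
    dsimp only
    rw [hτ i hi]
    by_cases h : i = N
    · subst h
      rw [Function.update_self, Function.update_self]
      exact fun t h1 h2 => hk.mem t (hset' h1 h2)
    · rw [hτ' i (hlt i hi h), hc i (hlt i hi h)]
      exact hχ.domain i hi
  · exact hχ.edge
  · intro i hi
    dsimp only
    rw [hτ' i hi, hc i hi]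
    exact hχ.guard i hi
  · intro i hi
    dsimp only
    rw [hτ' i hi, hc i hi, hstart _ hi]
    exact hχ.reset i hi

/-- Append an interval of length zero to an execution that ends at a state of a guard. -/
theorem append_jump (hχ : H.IsExecution q₀ x₀ χ) {N : ℕ} (hN : N ∈ χ.I) (hN' : N + 1 ∉ χ.I)
    {b : ℝ} (hb : χ.τ (N + 1) = b) (hcont : ContinuousOn (χ.c N) (Icc (χ.τ N).toReal b))
    {q : Q} (he : (χ.mode N, q) ∈ H.E) (hG : χ.c N b ∈ H.G (χ.mode N, q)) :
    H.IsExecution q₀ x₀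
      { I := insert (N + 1) χ.I
        τ := Function.update χ.τ (N + 2) b
        mode := Function.update χ.mode (N + 1) q
        c := Function.update χ.c (N + 1) fun _ => H.φ (χ.mode N, q) (χ.c N b) } := by
  have hle : ∀ i ∈ χ.I, i ≤ N := fun i hi => by
    by_contra! h
    exact hN' (hχ.mem_of_le h hi)
  have hle' : ∀ i ∈ insert (N + 1) χ.I, i = N + 1 ∨ i ≤ N := fun i hi => hi.imp id (hle i)
  have hτ : ∀ i, i ≤ N + 1 → Function.update χ.τ (N + 2) (b : EReal) i = χ.τ i := fun i hi =>
    Function.update_of_ne (by omega) _ _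
  have hm : ∀ i, i ≤ N → Function.update χ.mode (N + 1) q i = χ.mode i := fun i hi =>
    Function.update_of_ne (by omega) _ _
  have hc : ∀ i, i ≤ N → Function.update χ.c (N + 1)
      (fun _ => H.φ (χ.mode N, q) (χ.c N b)) i = χ.c i := fun i hi =>
    Function.update_of_ne (by omega) _ _
  have hmem : ∀ i, i ≤ N → i ∈ χ.I := fun i hi => hχ.mem_of_le hi hN
  have hcoe := hχ.coe_toReal_time hN
  -- The new interval starts and ends at `b`, so its flow and domain conditions are vacuous.
  have hempty : ∀ t : ℝ, (b : EReal) ≤ t → (t : EReal) < b → False :=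
    fun t h1 h2 => h1.not_gt h2
  constructor
  · exact Or.inr hχ.zero_mem
  · intro i hi
    refine Or.inr ?_
    rcases hle' _ hi with h | h
    · exact hmem i (by omega)
    · exact hmem i (by omega)
  · exact (hτ 0 (by omega)).trans hχ.time_zero
  · intro i hi
    rcases hle' _ hi with rfl | h
    · simp [hb]
    · dsimp only
      rw [hτ i (by omega)]
      exact hχ.time_ne_top i (hmem i h)
  · intro i hi
    dsimp only
    rcases hle' _ hi with rfl | h
    · simp [hb]
    · rw [hτ i (by omega), hτ (i + 1) (by omega)]
      exact hχ.time_le i (hmem i h)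
  · exact (hm 0 (by omega)).trans hχ.init_mode
  · dsimp only
    rw [hc 0 (by omega)]
    exact hχ.init_state
  · intro i hi
    dsimp only
    rcases hle' _ hi with rfl | h
    · rw [Function.update_self]
      exact continuousOn_const
    · rw [hτ i (by omega), hτ (i + 1) (by omega), hc i h]
      exact hχ.continuous i (hmem i h)
  · intro i hi
    dsimp only
    have h : i ≤ N := by rcases hle' _ hi with h | h <;> omega
    rw [hτ i (by omega), hτ (i + 1) (by omega), hc i h]
    by_cases h' : i = N
    · subst h'
      refine hcont.mono fun t ht => ⟨?_, ?_⟩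
      · rw [← EReal.coe_le_coe_iff, hcoe]; exact ht.1
      · rw [← EReal.coe_le_coe_iff, ← hb]; exact ht.2
    · exact hχ.continuous_end i (hmem _ (by omega))
  · intro i hi
    dsimp only
    rcases hle' _ hi with rfl | h
    · rw [hτ _ le_rfl, hb, Function.update_self]
      exact fun t h1 h2 => (hempty t h1.le h2).elim
    · rw [hτ i (by omega), hτ (i + 1) (by omega), hc i h, hm i h]
      exact hχ.flow i (hmem i h)
  · intro i hi
    dsimp only
    rcases hle' _ hi with rfl | h
    · rw [hτ _ le_rfl, hb, Function.update_self]
      exact fun t h1 h2 => (hempty t h1.le h2).elim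
    · rw [hτ i (by omega), hτ (i + 1) (by omega), hc i h, hm i h]
      exact hχ.domain i (hmem i h)
  · intro i hi
    dsimp only
    have h : i ≤ N := by rcases hle' _ hi with h | h <;> omega
    rw [hm i h]
    by_cases h' : i = N
    · subst h'
      rwa [Function.update_self]
    · rw [hm (i + 1) (by omega)]
      exact hχ.edge i (hmem _ (by omega))
  · intro i hi
    dsimp only
    have h : i ≤ N := by rcases hle' _ hi with h | h <;> omega
    rw [hm i h, hτ (i + 1) (by omega), hc i h]
    by_cases h' : i = N
    · subst h'
      rwa [Function.update_self, hb, EReal.toReal_coe]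
    · rw [hm (i + 1) (by omega)]
      exact hχ.guard i (hmem _ (by omega))
  · intro i hi
    dsimp only
    have h : i ≤ N := by rcases hle' _ hi with h | h <;> omega
    rw [hm i h, hτ (i + 1) (by omega), hc i h]
    by_cases h' : i = N
    · subst h'
      rw [Function.update_self, Function.update_self, hb, EReal.toReal_coe]
    · rw [hm (i + 1) (by omega), hc (i + 1) (by omega)]
      exact hχ.reset i (hmem _ (by omega))

end IsExecution

/-! ### Executions under a Lyapunov certificate -/

namespace IsLyapunov

variable {v : Q → State n → ℝ} {α γ : ℝ} {r : Q → ℝ} {ρ ρ₁ : ℝ}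
  {q₀ : Q} {x₀ : State n} {χ : Arc Q n}

/-- Along an execution, one interval and the jump that follows it. -/
theorem execution_step (h : H.IsLyapunov v α γ r ρ ρ₁) (hχ : H.IsExecution q₀ x₀ χ) {i : ℕ}
    (hi : i + 1 ∈ χ.I) (hx : χ.c i (χ.τ i).toReal ∈ H.sublevel v α ρ ρ₁ (χ.mode i)) :
    χ.c i (χ.τ (i + 1)).toReal ∈ H.sublevel v α ρ ρ₁ (χ.mode i) ∧
    χ.c (i + 1) (χ.τ (i + 1)).toReal ∈ H.sublevel v α ρ ρ₁ (χ.mode (i + 1)) ∧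
    v (χ.mode i) (χ.c i (χ.τ (i + 1)).toReal) + γ * ((χ.τ (i + 1)).toReal - (χ.τ i).toReal) ≤
      v (χ.mode i) (χ.c i (χ.τ i).toReal) ∧
    v (χ.mode (i + 1)) (χ.c (i + 1) (χ.τ (i + 1)).toReal) ≤
      r (χ.mode i) * v (χ.mode i) (χ.c i (χ.τ (i + 1)).toReal) := by
  obtain ⟨h1, h2⟩ := h.flow_mem_sublevel (hχ.toReal_time_le hi)
    (hχ.isFlow (hχ.mem_of_succ_mem i hi) (hχ.coe_toReal_time hi).le) (hχ.continuousOn_Icc hi) hx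
  obtain ⟨h3, h4⟩ := h.reset_mem_sublevel (hχ.edge i hi) h1 (hχ.guard i hi)
  rw [← hχ.reset i hi] at h3 h4
  exact ⟨h1, h3, h2, h4⟩

theorem execution_invariant (h : H.IsLyapunov v α γ r ρ ρ₁) (hχ : H.IsExecution q₀ x₀ χ)
    (hx₀ : x₀ ∈ H.sublevel v α ρ ρ₁ q₀) (i : ℕ) (hi : i ∈ χ.I) :
    χ.c i (χ.τ i).toReal ∈ H.sublevel v α ρ ρ₁ (χ.mode i) ∧
    v (χ.mode i) (χ.c i (χ.τ i).toReal) + γ * (χ.τ i).toReal ≤ v q₀ x₀ := by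
  induction i with
  | zero =>
    rw [hχ.time_zero, EReal.toReal_zero, hχ.init_state, hχ.init_mode]
    exact ⟨hx₀, by simp⟩
  | succ i ih =>
    obtain ⟨ih1, ih2⟩ := ih (hχ.mem_of_succ_mem i hi)
    obtain ⟨h1, h2, h3, h4⟩ := h.execution_step hχ hi ih1
    refine ⟨h2, ?_⟩
    have := mul_le_mul_of_nonneg_right (h.r_le_one (χ.mode i)) (h.nonneg h1)
    linarith

/-- All the times of an execution that starts in a sublevel set are bounded. -/
theorem execution_time_le (h : H.IsLyapunov v α γ r ρ ρ₁) (hχ : H.IsExecution q₀ x₀ χ)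
    (hx₀ : x₀ ∈ H.sublevel v α ρ ρ₁ q₀) {i : ℕ} (hi : i ∈ χ.I) :
    χ.τ (i + 1) ≤ ((v q₀ x₀ / γ : ℝ) : EReal) := by
  obtain ⟨h1, h2⟩ := h.execution_invariant hχ hx₀ i hi
  by_contra! hlt
  -- At a time `t` of this interval with `γ t > v q₀ x₀`, the decrease of `v + γ t` would make `v`
  -- negative.
  obtain ⟨t, ht1, ht2⟩ := EReal.lt_iff_exists_real_btwn.1 hlt
  rw [EReal.coe_lt_coe_iff, div_lt_iff₀ h.γ_pos] at ht1
  have ht0 : (χ.τ i).toReal ≤ t := by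
    have := h.nonneg h1
    have := h.γ_pos
    nlinarith
  obtain ⟨t', ht3, ht4⟩ := EReal.lt_iff_exists_real_btwn.1 ht2
  obtain ⟨h3, h4⟩ := h.flow_mem_sublevel_of_mem_Ico (hχ.isFlow hi ht4.le) h1
    ⟨ht0, EReal.coe_lt_coe_iff.1 ht3⟩
  have := h.nonneg h3
  linarith

/-- The time bound excludes an unbounded last interval and makes the monotone times converge to a
finite supremum. -/
theorem isZeno_of_isComplete (h : H.IsLyapunov v α γ r ρ ρ₁) (hχ : H.IsExecution q₀ x₀ χ)
    (hx₀ : x₀ ∈ H.sublevel v α ρ ρ₁ q₀) (hcomp : χ.IsComplete) : χ.IsZeno := by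
  have hI : χ.I = univ := by
    rcases hcomp with hI | ⟨i, hi, htop⟩
    · exact hI
    · have := h.execution_time_le hχ hx₀ hi
      rw [htop] at this
      exact absurd (top_le_iff.1 this) (EReal.coe_ne_top _)
  have hmem : ∀ i, i ∈ χ.I := fun i => hI ▸ mem_univ i
  refine ⟨hI, (⨆ i, χ.τ i).toReal, ?_⟩
  have hmono : Monotone χ.τ := monotone_nat_of_le_succ fun i => hχ.time_le i (hmem i)
  have hle : (⨆ i, χ.τ i) ≤ ((v q₀ x₀ / γ : ℝ) : EReal) :=
    iSup_le fun i => (hmono i.le_succ).trans (h.execution_time_le hχ hx₀ (hmem i))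
  have hge : 0 ≤ ⨆ i, χ.τ i := hχ.time_zero.ge.trans (le_iSup χ.τ 0)
  rw [EReal.coe_toReal (ne_of_lt (hle.trans_lt (EReal.coe_lt_top _)))
    (ne_of_gt (EReal.bot_lt_zero.trans_le hge))]
  exact tendsto_atTop_iSup hmono

theorem convergesTo_zero [Finite Q] (h : H.IsLyapunov v α γ r ρ ρ₁) (hH : H.IsCyclic)
    (hχ : H.IsExecution q₀ x₀ χ) (hx₀ : x₀ ∈ H.sublevel v α ρ ρ₁ q₀) (hI : χ.I = univ) :
    χ.ConvergesTo fun _ => 0 := by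
  have hmem : ∀ i, i ∈ χ.I := fun i => hI ▸ mem_univ i
  have hinv : ∀ i, χ.c i (χ.τ i).toReal ∈ H.sublevel v α ρ ρ₁ (χ.mode i) :=
    fun i => (h.execution_invariant hχ hx₀ i (hmem i)).1
  set u : ℕ → ℝ := fun i => v (χ.mode i) (χ.c i (χ.τ i).toReal) with hu
  have hu0 : ∀ i, 0 ≤ u i := fun i => h.nonneg (hinv i)
  have hend : ∀ i, χ.c i (χ.τ (i + 1)).toReal ∈ H.sublevel v α ρ ρ₁ (χ.mode i) ∧
      v (χ.mode i) (χ.c i (χ.τ (i + 1)).toReal) ≤ u i := fun i => by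
    obtain ⟨h1, -, h2, -⟩ := h.execution_step hχ (hmem (i + 1)) (hinv i)
    have := mul_nonneg h.γ_pos.le (sub_nonneg.2 (hχ.toReal_time_le (hmem (i + 1))))
    exact ⟨h1, by linarith⟩
  have hstep : ∀ i, u (i + 1) ≤ r (χ.mode i) * u i := fun i =>
    (h.execution_step hχ (hmem (i + 1)) (hinv i)).2.2.2.trans
      (mul_le_mul_of_nonneg_left (hend i).2 (h.r_nonneg _))
  have hanti : Antitone u := antitone_nat_of_succ_le fun i =>
    (hstep i).trans (mul_le_of_le_one_left (hu0 i) (h.r_le_one _))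
  obtain ⟨q, hq⟩ := h.r_lt_one
  obtain ⟨K, hK⟩ := hH.exists_visit
  have hlim : Tendsto u atTop (𝓝 0) := by
    refine tendsto_zero_of_contraction hanti hu0 hq (K := K) fun i => ?_
    obtain ⟨j, hij, hjK, rfl⟩ := hK χ.mode (fun i => hχ.edge i (hmem _)) q i
    -- With a visit to the contracting mode at `j` in the window: `u (i + K) ≤ u (j + 1) ≤ r * u j ≤
    -- r * u i`.
    exact (hanti hjK).trans ((hstep j).trans
      (mul_le_mul_of_nonneg_left (hanti hij) (h.r_nonneg _)))
  intro ε hε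
  obtain ⟨N, hN⟩ := eventually_atTop.1
    (hlim.eventually (gt_mem_nhds (mul_pos h.α_pos (pow_pos hε 2))))
  refine ⟨N, fun i hi => ?_⟩
  rw [sub_zero]
  have h1 := (h.lower _ _ (hend i).1.1 (hend i).1.2.1).trans_lt ((hend i).2.trans_lt (hN i hi.le))
  exact (lt_of_pow_lt_pow_left₀ 2 hε.le (lt_of_mul_lt_mul_left h1 h.α_pos.le)).le

/-- An incomplete execution has a last interval with finite end. After the limit is inserted there,
the non-blocking condition allows a further jump or a longer flow. -/
theorem isComplete_of_isMaximalExecution (h : H.IsLyapunov v α γ r ρ ρ₁)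
    (hnb : H.IsNonblockingOn v α ρ ρ₁) (hχ : H.IsMaximalExecution q₀ x₀ χ)
    (hx₀ : x₀ ∈ H.sublevel v α ρ ρ₁ q₀) : χ.IsComplete := by
  obtain ⟨hχ, hmax⟩ := hχ
  by_contra hcomp
  simp only [Arc.IsComplete, not_or, not_exists, not_and] at hcomp
  obtain ⟨N, hN, hN'⟩ : ∃ N ∈ χ.I, N + 1 ∉ χ.I := by
    by_contra! hcon
    exact hcomp.1 (eq_univ_of_forall fun i => Nat.rec hχ.zero_mem (fun k hk => hcon k hk) i)
  have hle := hχ.time_le N hN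
  obtain ⟨b, hb⟩ : ∃ b : ℝ, χ.τ (N + 1) = b :=
    ⟨(χ.τ (N + 1)).toReal, (EReal.coe_toReal (hcomp.2 N hN) (ne_of_gt
      (EReal.bot_lt_zero.trans_le ((hχ.time_nonneg N hN).trans hle)))).symm⟩
  have hab : (χ.τ N).toReal ≤ b := by
    rwa [hb, ← hχ.coe_toReal_time hN, EReal.coe_le_coe_iff] at hle
  have hc := hχ.isFlow hN hb.ge
  have ha := (h.execution_invariant hχ hx₀ N hN).1
  obtain ⟨y, hy, hya⟩ := h.exists_flow_limit hab hc ha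
  have hupd : ∀ t ∈ Ico (χ.τ N).toReal b, Function.update (χ.c N) b y t = χ.c N t :=
    fun t ht => Function.update_of_ne ht.2.ne _ _
  have hc' := hc.congr hupd
  have hyb := (h.flow_mem_sublevel hab hc' hy (by rw [hya]; exact ha)).1
  -- The order on arcs ignores the value at the end of the last interval, so the limit `y` may
  -- replace it. For an interval of length zero this is also the start, hence the hypothesis on `k`
  -- there.
  have hle_of : ∀ (k : ℝ → State n) (b' : ℝ), b ≤ b' →
      k (χ.τ N).toReal = χ.c N (χ.τ N).toReal →
      (∀ t ∈ Ico (χ.τ N).toReal b, k t = χ.c N t) →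
      χ.Le { χ with τ := Function.update χ.τ (N + 1) b', c := Function.update χ.c N k } := by
    intro k b' hbb hk0 hk
    refine ⟨Subset.rfl, fun i hi => ?_⟩
    have hiN : i ≤ N := by
      by_contra! h
      exact hN' (hχ.mem_of_le h hi)
    dsimp only
    rw [Function.update_of_ne (by omega : i ≠ N + 1)]
    by_cases hne : i = N
    · subst hne
      rw [Function.update_self, Function.update_self, hb]
      refine ⟨rfl, rfl, EReal.coe_le_coe_iff.2 hbb, hk0.symm, fun t h1 h2 => (hk t ⟨?_, ?_⟩).symm⟩
      · rwa [← hχ.coe_toReal_time hi, EReal.coe_le_coe_iff] at h1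
      · exact EReal.coe_lt_coe_iff.1 h2
    · rw [Function.update_of_ne (by omega : i + 1 ≠ N + 1), Function.update_of_ne hne]
      exact ⟨rfl, rfl, le_rfl, rfl, fun _ _ _ => rfl⟩
  rcases hnb _ _ hyb with ⟨⟨q, q'⟩, he, rfl, hG⟩ | hf
  · have h1 := hχ.replace_last hN hN' hab hya hc'
    have h2 := h1.append_jump hN hN' (b := b) (q := q') (by simp)
      (by simpa using hy) he (by simpa using hG)
    refine hN' ((hmax _ h2 ((hle_of _ b le_rfl hya hupd).trans ⟨subset_insert _ _, ?_⟩)).1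
      (mem_insert _ _))
    intro i hi
    have hiN : i ≤ N := by
      by_contra! h
      exact hN' (hχ.mem_of_le h hi)
    dsimp only
    have e1 : i ≠ N + 2 := by omega
    have e2 : i ≠ N + 1 := by omega
    have e3 : i + 1 ≠ N + 2 := by omega
    simp [Function.update_of_ne e1, Function.update_of_ne e2, Function.update_of_ne e3]
  · obtain ⟨b', hb', d, hd0, hd⟩ := hf.exists_isFlow b
    have hjoin := hc'.join (h.continuous_field _) hab hb' hy hd hd0 hyb.1
    have hk : ∀ t ∈ Ico (χ.τ N).toReal b,
        (if t < b then Function.update (χ.c N) b y t else d t) = χ.c N t :=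
      fun t ht => (if_pos ht.2).trans (hupd t ht)
    have hk0 : (if (χ.τ N).toReal < b then Function.update (χ.c N) b y (χ.τ N).toReal
        else d (χ.τ N).toReal) = χ.c N (χ.τ N).toReal := by
      rcases hab.eq_or_lt with e | e
      · rw [if_neg e.not_lt, ← hya, e, hd0]
      · rw [if_pos e, hya]
    have hL := hmax _ (hχ.replace_last hN hN' (hab.trans hb'.le) hk0 hjoin)
      (hle_of _ b' hb'.le hk0 hk)
    have h1 := (hL.2 N hN).2.2.1
    dsimp only at h1
    rw [Function.update_self, hb, EReal.coe_le_coe_iff] at h1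
    exact h1.not_gt hb'

/-- Flow to a guard, jump, repeat: the reset state is again in a sublevel set, so the step can be
iterated. -/
theorem exists_infinite_execution (h : H.IsLyapunov v α γ r ρ ρ₁)
    (hnb : H.IsNonblockingOn v α ρ ρ₁) (hx₀ : x₀ ∈ H.sublevel v α ρ ρ₁ q₀) :
    ∃ χ, H.IsExecution q₀ x₀ χ ∧ χ.I = univ := by
  let S : Type _ := {s : Q × State n // s.2 ∈ H.sublevel v α ρ ρ₁ s.1}
  have hflow : ∀ s : S, ∃ (T : ℝ) (c : ℝ → State n) (s' : S), 0 ≤ T ∧ c 0 = s.1.2 ∧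
      H.IsFlow s.1.1 c 0 T ∧ ContinuousOn c (Icc 0 T) ∧ (s.1.1, s'.1.1) ∈ H.E ∧
      c T ∈ H.G (s.1.1, s'.1.1) ∧ s'.1.2 = H.φ (s.1.1, s'.1.1) (c T) := by
    rintro ⟨⟨q, x⟩, hx⟩
    obtain ⟨T, hT, c, hc0, hc, hcc, ⟨q₁, q'⟩, he, rfl, hG⟩ := h.exists_flow_to_guard hnb hx
    have h1 := (h.flow_mem_sublevel hT hc hcc (by rw [hc0]; exact hx)).1
    exact ⟨T, c, ⟨(q', _), (h.reset_mem_sublevel he h1 hG).1⟩, hT, hc0, hc, hcc, he, hG, rfl⟩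
  choose T c next hT hc0 hc hcc he hG hφ using hflow
  let s : ℕ → S := fun i => next^[i] ⟨(q₀, x₀), hx₀⟩
  have hs : ∀ i, s (i + 1) = next (s i) := fun i => Function.iterate_succ_apply' next i _
  -- Each piece is parametrized from time `0`; the partial sums of the durations are the shifts.
  let t : ℕ → ℝ := fun i => ∑ k ∈ Finset.range i, T (s k)
  have ht : ∀ i, t (i + 1) = T (s i) + t i := fun i =>
    (Finset.sum_range_succ (fun k => T (s k)) i).trans (add_comm _ _)
  have hf : ∀ i, H.IsFlow (s i).1.1 (fun u => c (s i) (u - t i)) (t i) (t (i + 1)) := fun i => by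
    have := (hc (s i)).comp_sub (t i)
    rwa [zero_add, ← ht] at this
  refine ⟨⟨univ, fun i => (t i : EReal), fun i => (s i).1.1, fun i u => c (s i) (u - t i)⟩,
    ?_, rfl⟩
  constructor
  · exact mem_univ _
  · exact fun _ _ => mem_univ _
  · simp [t]
  · exact fun i _ => EReal.coe_ne_top _
  · intro i _
    have := hT (s i)
    exact EReal.coe_le_coe_iff.2 (by rw [ht]; linarith)
  · rfl
  · have ht0 : t 0 = 0 := Finset.sum_range_zero _
    dsimp only
    rw [ht0, sub_zero]
    exact hc0 (s 0)
  · exact fun i _ => (hf i).cont.mono fun u hu =>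
      ⟨EReal.coe_le_coe_iff.1 hu.1, EReal.coe_lt_coe_iff.1 hu.2⟩
  · intro i _
    refine (hcc (s i)).comp (by fun_prop) fun u hu => ?_
    have h1 := EReal.coe_le_coe_iff.1 hu.1
    have h2 := EReal.coe_le_coe_iff.1 hu.2
    rw [ht] at h2
    exact ⟨by linarith, by linarith⟩
  · exact fun i _ u h1 h2 => (hf i).deriv u ⟨EReal.coe_lt_coe_iff.1 h1, EReal.coe_lt_coe_iff.1 h2⟩
  · exact fun i _ u h1 h2 => (hf i).mem u ⟨EReal.coe_lt_coe_iff.1 h1, EReal.coe_lt_coe_iff.1 h2⟩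
  · intro i _
    dsimp only
    rw [hs]
    exact he (s i)
  · intro i _
    dsimp only
    rw [hs, EReal.toReal_coe, ht, add_sub_cancel_right]
    exact hG (s i)
  · intro i _
    dsimp only
    rw [EReal.toReal_coe, sub_self, hc0, hs, ht, add_sub_cancel_right]
    exact hφ (s i)

theorem isZenoStable [Finite Q] (h : H.IsLyapunov v α γ r ρ ρ₁) (hH : H.IsCyclic)
    (hnb : H.IsNonblockingNear (fun _ => 0) → H.IsNonblockingOn v α ρ ρ₁) :
    H.IsZenoStable fun _ => 0 := by
  refine ⟨fun q => {x | ‖x‖ ≤ ρ ∧ v q x < α * ρ₁ ^ 2}, fun q => ?_, fun q x hx => ?_⟩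
  · refine inter_mem ?_ ?_
    · filter_upwards [Metric.closedBall_mem_nhds (0 : State n) (h.radius_pos.trans_le h.radius_le)]
        with x hx using mem_closedBall_zero_iff.1 hx
    · refine (h.differentiable q).continuous.continuousAt.eventually (gt_mem_nhds ?_)
      rw [h.apply_zero]
      exact mul_pos h.α_pos (pow_pos h.radius_pos 2)
  · have hx' : x ∈ H.sublevel v α ρ ρ₁ q := ⟨hx.2, hx.1⟩
    have hcomp : ∀ χ, H.IsExecution q x χ → χ.IsComplete →
        χ.IsZeno ∧ χ.ConvergesTo fun _ => 0 := fun χ hχ hc =>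
      have hZ := h.isZeno_of_isComplete hχ hx' hc
      ⟨hZ, h.convergesTo_zero hH hχ hx' hZ.1⟩
    refine ⟨hcomp, fun hN => ⟨?_, fun χ hχ => ?_⟩⟩
    · obtain ⟨χ, hχ, hI⟩ := h.exists_infinite_execution (hnb hN) hx'
      exact ⟨χ, hχ, (hcomp χ hχ (Or.inl hI)).1⟩
    · exact hcomp χ hχ.1 (h.isComplete_of_isMaximalExecution (hnb hN) hχ hx')

end IsLyapunov

end HybridSystem

/-! ### Polynomials as functions of the state -/

namespace Poly

variable {n m : ℕ}

theorem continuous_val (a : Poly n m) (p : Fin m → ℝ) : Continuous fun x => a.val x p := by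
  refine a.continuous_eval.comp (continuous_pi fun i => ?_)
  rcases i with j | k
  · exact (EuclideanSpace.proj (𝕜 := ℝ) j).continuous
  · exact continuous_const

theorem val_nonneg_of_isSumSq {a : Poly n m} (ha : IsSumSq a) (x : State n) (p : Fin m → ℝ) :
    0 ≤ a.val x p := by
  induction ha with
  | zero => simp [val]
  | sq_add b _ ih =>
    simp only [val, map_add, map_mul] at ih ⊢
    exact add_nonneg (mul_self_nonneg _) ih

/-- Links formal partial derivatives to the Fréchet derivative in `x`, so that `lieDeriv` is the
derivative along the field. -/
theorem hasFDerivAt_val (a : Poly n m) (p : Fin m → ℝ) (x : State n) :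
    HasFDerivAt (fun y => a.val y p)
      (∑ j, (val (MvPolynomial.pderiv (Sum.inl j) a) x p) •
        (EuclideanSpace.proj j : State n →L[ℝ] ℝ)) x := by
  induction a using MvPolynomial.induction_on with
  | C r => simpa [val] using hasFDerivAt_const r x
  | add a b iha ihb =>
    have := iha.add ihb
    simp only [val, map_add, add_smul, Finset.sum_add_distrib] at this ⊢
    exact this
  | mul_X a i ih =>
    rcases i with j | k
    · have := ih.mul (EuclideanSpace.proj (𝕜 := ℝ) j : State n →L[ℝ] ℝ).hasFDerivAt
      have hfun : (fun y => val (a * MvPolynomial.X (Sum.inl j)) y p) =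
          (fun y => val a y p) * ⇑(EuclideanSpace.proj (𝕜 := ℝ) j : State n →L[ℝ] ℝ) := by
        ext y
        simp [val]
      rw [hfun]
      refine this.congr_fderiv ?_
      ext u
      simp [val, Finset.sum_add_distrib, add_mul, Finset.mul_sum, MvPolynomial.pderiv_X,
        Pi.single_apply, ite_mul, mul_assoc, apply_ite]
    · have := ih.mul_const (p k)
      refine HasFDerivAt.congr_fderiv (f := fun y => val (a * MvPolynomial.X (Sum.inr k)) y p)
        (by simpa [val] using this) ?_
      ext u
      simp [val, Finset.mul_sum, MvPolynomial.pderiv_X, mul_assoc]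

theorem val_bind₁ (a : Poly n m) (s : Fin n → Poly n m) (x : State n) (p : Fin m → ℝ) :
    val (MvPolynomial.bind₁ (Sum.elim s fun k => MvPolynomial.X (Sum.inr k)) a) x p =
      a.val (WithLp.toLp 2 fun j => (s j).val x p) p := by
  unfold val
  change MvPolynomial.eval₂Hom _ _ _ = _
  rw [MvPolynomial.eval₂Hom_bind₁]
  congr 2
  ext i
  rcases i with j | k
  · rfl
  · simp

end Poly

/-! ### From sums of squares to pointwise inequalities -/

namespace UncertainModel

variable {Q : Type*} {n m : ℕ} {M : UncertainModel Q n m}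

theorem isClosed_D (M : UncertainModel Q n m) (p : Fin m → ℝ) (q : Q) : IsClosed (M.D p q) := by
  simp only [D, ofPred_forall]
  exact isClosed_iInter fun k => isClosed_le continuous_const ((M.g q k).continuous_val p)

theorem continuous_field (M : UncertainModel Q n m) (p : Fin m → ℝ) (q : Q) :
    Continuous (M.field p q) :=
  (PiLp.continuous_toLp 2 _).comp (continuous_pi fun j => (M.f q j).continuous_val p)

theorem continuous_resetMap (M : UncertainModel Q n m) (p : Fin m → ℝ) (e : Q × Q) :
    Continuous (M.resetMap p e) :=
  (PiLp.continuous_toLp 2 _).comp (continuous_pi fun j => (M.φ e j).continuous_val p)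

theorem val_lieDeriv (M : UncertainModel Q n m) (q : Q) (V : Poly n m) (x : State n)
    (p : Fin m → ℝ) :
    (M.lieDeriv q V).val x p = fderiv ℝ (fun y => V.val y p) x (M.field p q x) := by
  rw [(V.hasFDerivAt_val p x).fderiv]
  simp [lieDeriv, Poly.val, field]

theorem val_compReset (M : UncertainModel Q n m) (e : Q × Q) (V : Poly n m) (x : State n)
    (p : Fin m → ℝ) : (M.compReset e V).val x p = V.val (M.resetMap p e x) p :=
  V.val_bind₁ (M.φ e) x p

theorem val_sqNorm (x : State n) (p : Fin m → ℝ) : (sqNorm n m).val x p = ‖x‖ ^ 2 := by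
  simp [sqNorm, Poly.val, EuclideanSpace.real_norm_sq_eq]

theorem val_liftX (w : MvPolynomial (Fin n) ℝ) (x : State n) (p : Fin m → ℝ) :
    (liftX w : Poly n m).val x p = MvPolynomial.eval (fun j => x j) w :=
  MvPolynomial.eval_rename _ _ _

theorem val_liftP (w : MvPolynomial (Fin m) ℝ) (x : State n) (p : Fin m → ℝ) :
    (liftP w : Poly n m).val x p = MvPolynomial.eval p w :=
  MvPolynomial.eval_rename _ _ _

theorem val_sum_mul_nonneg {N : ℕ} {a b : Fin N → Poly n m} (ha : ∀ k, IsSumSq (a k))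
    {x : State n} {p : Fin m → ℝ} (hb : ∀ k, 0 ≤ (b k).val x p) :
    0 ≤ (∑ k, a k * b k : Poly n m).val x p := by
  unfold Poly.val
  rw [map_sum]
  refine Finset.sum_nonneg fun k _ => ?_
  rw [map_mul]
  exact mul_nonneg (Poly.val_nonneg_of_isSumSq (ha k) x p) (hb k)

namespace SOSSolution

variable {z : Q → State n} {numw : Q → ℕ} {w : (q : Q) → Fin (numw q) → MvPolynomial (Fin n) ℝ}
  {p : Fin m → ℝ}

theorem lower_bound (s : M.SOSSolution z w) (hp : p ∈ M.P) {q : Q} {x : State n} (hx : x ∈ M.D p q)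
    (hw : ∀ k, 0 < MvPolynomial.eval (fun j => x j) (w q k)) :
    s.α * ‖x‖ ^ 2 ≤ (s.V q).val x p := by
  have h := Poly.val_nonneg_of_isSumSq (s.positivity q) x p
  have h1 := val_sum_mul_nonneg (s.sos_a q) (b := fun k => liftX (w q k)) (x := x) (p := p)
    fun k => by rw [val_liftX]; exact (hw k).le
  have h2 := val_sum_mul_nonneg (s.sos_b q) (b := M.g q) (x := x) (p := p) hx
  have h3 := val_sum_mul_nonneg (s.sos_η q) (b := fun k => liftP (M.π k)) (x := x) (p := p)
    fun k => by rw [val_liftP]; exact hp k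
  rw [← val_sqNorm x p]
  unfold Poly.val at *
  simp only [map_sub, map_mul, MvPolynomial.eval_C] at h
  linarith

theorem fderiv_le (s : M.SOSSolution z w) (hp : p ∈ M.P) {q : Q} {x : State n} (hx : x ∈ M.D p q)
    (hw : ∀ k, 0 < MvPolynomial.eval (fun j => x j) (w q k)) :
    fderiv ℝ (fun y => (s.V q).val y p) x (M.field p q x) ≤ -s.γ := by
  have h := Poly.val_nonneg_of_isSumSq (s.decrease q) x p
  have h1 := val_sum_mul_nonneg (s.sos_c q) (b := fun k => liftX (w q k)) (x := x) (p := p)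
    fun k => by rw [val_liftX]; exact (hw k).le
  have h2 := val_sum_mul_nonneg (s.sos_d q) (b := M.g q) (x := x) (p := p) hx
  have h3 := val_sum_mul_nonneg (s.sos_β q) (b := fun k => liftP (M.π k)) (x := x) (p := p)
    fun k => by rw [val_liftP]; exact hp k
  rw [← val_lieDeriv]
  unfold Poly.val at *
  simp only [map_sub, map_neg, MvPolynomial.eval_C] at h
  linarith

theorem reset_le (s : M.SOSSolution z w) (hp : p ∈ M.P) {e : Q × Q} (he : e ∈ M.E)
    {x : State n} (hx : x ∈ M.G p e)
    (hw : ∀ k, 0 < MvPolynomial.eval (fun j => x j) (w e.1 k)) :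
    (s.V e.2).val (M.resetMap p e x) p ≤ s.r e.1 * (s.V e.1).val x p := by
  have h := Poly.val_nonneg_of_isSumSq (s.jump e he) x p
  have h1 := val_sum_mul_nonneg (s.sos_i e.1) (b := fun k => liftX (w e.1 k)) (x := x) (p := p)
    fun k => by rw [val_liftX]; exact (hw k).le
  have h2 := val_sum_mul_nonneg (s.sos_j e.1) (b := M.g e.1) (x := x) (p := p) hx.1
  have h3 := val_sum_mul_nonneg (s.sos_ζ e.1) (b := fun k => liftP (M.π k)) (x := x) (p := p)
    fun k => by rw [val_liftP]; exact hp k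
  have h4 := val_sum_mul_nonneg (s.sos_mult e he) (b := M.h e) (x := x) (p := p) hx.2.2
  have h5 := hx.2.1
  rw [← val_compReset]
  unfold Poly.val at *
  -- On the guard `h₀` vanishes, so the multiplier `mult₀` needs no sign.
  simp only [map_sub, map_mul, MvPolynomial.eval_C, h5, mul_zero] at h
  linarith

/-- The lower bound at `z q`, where `V` vanishes, reads `α‖z q‖² ≤ 0`. -/
theorem eq_zero (s : M.SOSSolution z w) (hp : p ∈ M.P) {q : Q} (hz : z q ∈ M.D p q)
    (hw : ∀ k, 0 < MvPolynomial.eval (fun j => z q j) (w q k)) : z q = 0 := by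
  have h := s.lower_bound hp hz hw
  rw [s.vanishing q p hp] at h
  have h1 : ‖z q‖ ^ 2 ≤ 0 := nonpos_of_mul_nonpos_right h s.α_pos
  exact norm_eq_zero.1 (pow_eq_zero_iff two_ne_zero |>.1 (le_antisymm h1 (sq_nonneg _)))

end SOSSolution

end UncertainModel

end ZenoSOS

/-! ### Choice of the radii and conclusion -/

theorem mainTheorem3 {Q : Type*} [Finite Q] {n m : ℕ}
    (M : ZenoSOS.UncertainModel Q n m) (hM : M.IsWellDefined)
    (hcyc : ∀ (p : Fin m → ℝ) (hp : p ∈ M.P), (M.system hM p hp).IsCyclic)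
    (z : Q → ZenoSOS.State n)
    (hz : ∀ (p : Fin m → ℝ) (hp : p ∈ M.P), (M.system hM p hp).IsZenoEquilibrium z)
    (numw : Q → ℕ) (w : (q : Q) → Fin (numw q) → MvPolynomial (Fin n) ℝ)
    (hW : ∀ q, {x : ZenoSOS.State n | ∀ k, 0 < MvPolynomial.eval (fun j => x j) (w q k)} ∈
      nhds (z q))
    (hfeas : Nonempty (M.SOSSolution z w)) :
    ∀ (p : Fin m → ℝ) (hp : p ∈ M.P),
      (M.system hM p hp).IsZenoEquilibrium z ∧ (M.system hM p hp).IsZenoStable z := by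
  intro p hp
  refine ⟨hz p hp, ?_⟩
  obtain ⟨s⟩ := hfeas
  have heq := hz p hp
  have hz0 : z = fun _ => 0 :=
    funext fun q => s.eq_zero hp (heq.mem q) (mem_of_mem_nhds (hW q))
  -- Finiteness of `Q` gives one ball inside all the sets `W q`.
  obtain ⟨ρ, hρ, hball⟩ := Metric.nhds_basis_closedBall.mem_iff.1
    (eventually_all.2 fun q => (hz0 ▸ hW q :))
  have hball' : ∀ x : ZenoSOS.State n, ‖x‖ ≤ ρ →
      ∀ q k, 0 < MvPolynomial.eval (fun j => x j) (w q k) :=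
    fun x hx => hball (mem_closedBall_zero_iff.2 hx)
  have hreset : ∀ᶠ x in 𝓝 (0 : ZenoSOS.State n), ∀ e, e ∈ M.E → ‖M.resetMap p e x‖ ≤ ρ := by
    refine eventually_all.2 fun e => ?_
    by_cases he : e ∈ M.E
    · have h0 : M.resetMap p e 0 = 0 := by
        have h1 := heq.reset e he
        simp only [hz0] at h1
        exact h1
      have h1 := (M.continuous_resetMap p e).norm.tendsto 0
      rw [h0, norm_zero] at h1
      filter_upwards [h1.eventually (gt_mem_nhds hρ)] with x hx _ using hx.le
    · exact Eventually.of_forall fun x h => absurd h he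
  -- Non-blocking is kept as a premise inside the neighbourhood, so that one radius serves both
  -- halves of Zeno stability.
  have hblock : ∀ᶠ x in 𝓝 (0 : ZenoSOS.State n),
      (M.system hM p hp).IsNonblockingNear (fun _ => 0) → ∀ q, x ∈ M.D p q →
        (∃ e ∈ M.E, e.1 = q ∧ x ∈ M.G p e) ∨ (M.system hM p hp).CanFlow q x := by
    by_cases hN : (M.system hM p hp).IsNonblockingNear fun _ => 0
    · filter_upwards [eventually_all.2 fun q => eventually_nhdsWithin_iff.1 (hN q)] with x hx _
        using hx
    · exact Eventually.of_forall fun x h => absurd h hN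
  obtain ⟨ρ', hρ', hsmall⟩ := Metric.nhds_basis_ball.mem_iff.1 (hreset.and hblock)
  have hsmall' : ∀ x : ZenoSOS.State n, ‖x‖ < min ρ ρ' → x ∈ Metric.ball 0 ρ' := fun x hx =>
    mem_ball_zero_iff.2 (hx.trans_le (min_le_right _ _))
  have hL : (M.system hM p hp).IsLyapunov (fun q x => (s.V q).val x p) s.α s.γ s.r ρ
      (min ρ ρ') :=
    { α_pos := s.α_pos
      γ_pos := s.γ_pos
      r_nonneg := fun q => (s.r_pos q).le
      r_le_one := s.r_le_one
      r_lt_one := s.r_lt_one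
      radius_pos := lt_min hρ hρ'
      radius_le := min_le_left _ _
      isClosed_domain := M.isClosed_D p
      continuous_field := M.continuous_field p
      differentiable := fun q x => ((s.V q).hasFDerivAt_val p x).differentiableAt
      apply_zero := fun q => by simpa only [hz0] using s.vanishing q p hp
      lower := fun q x hx hn => s.lower_bound hp hx (hball' x hn q)
      decrease := fun q x hx hn => s.fderiv_le hp hx (hball' x hn q)
      jump := fun e he x hx hn => s.reset_le hp he hx (hball' x hn e.1)
      reset_norm := fun e he x _ hn => (hsmall (hsmall' x hn)).1 e he }
  rw [hz0]
  exact hL.isZenoStable (hcyc p hp) fun hN q x hx =>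
    (hsmall (hsmall' x (hL.norm_lt hx))).2 hN q hx.1
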